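/- **Conventions.** A connected graph is a metric space with the graph metric (each edge has length $1$); it is hyperbolic if there is $\delta>0$ such that each side of every geodesic triangle lies in the closed $\delta$-neighbourhood of the union of the other two sides. A group is hyperbolic if it has a finite generating set whose Cayley graph is hyperbolic. A subset $A$ of a graph is quasi-convex with constant $C$ if all geodesics with endpoints in $A$ lie in the closed $C$-neighbourhood of $A$. For a generating set $S$ of $G$ and a family $\mathcal H$ of subgroups, the coned-off Cayley graph is $\mathrm{Cay}(G,S\cup\bigcup_{H\in\mathcal H}H)$. The group $G$ acts on these graphs by left multiplication. Let $G$ act by automorphisms on a hyperbolic graph $X$, let $x_0$ be a vertex of $X$, and let $d_G$ be the word metric of a finite generating set $T$ of $G$. An element $g\in G$ is *loxodromic* if $n\mapsto g^nx_0$ is a quasi-isometric embedding $\mathbb Z\to X$. An *$X$-projection* onto $\langle g\rangle$ is a map $\pi:G\to\langle g\rangle$ such that, for all $h\in G$, $\pi(h)x_0$ is a closest point to $hx_0$ in $\langle g\rangle x_0$. The element $g$ is *super-divergent* (with respect to $x_0$ and $T$) if it is loxodromic, $X$-projections onto $\langle g\rangle$ exist, and every such projection $\pi$ restricts to the identity on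 $\langle g\rangle$ and has the following property: there are $\theta>0$ and $f:(0,\infty)\to(0,\infty)$ with $f(t)/t\to\infty$ as $t\to\infty$ such that, for all $d>0$ and all edge paths $p$ in $\mathrm{Cay}(G,T)$ from $p_-$ to $p_+$ all of whose vertices are at $d_G$-distance greater than $d$ from $\langle g\rangle$, if $d_G(\pi(p_-),\pi(p_+))>\theta$ then the length of $p$ is greater than $f(d)$. **Lemma.** Let $G$ be an infinite hyperbolic group and let $S$ be a finite generating set of $G$. 1. The Cayley graph $X=\mathrm{Cay}(G,S)$ is hyperbolic, and $G$ contains an element that is super-divergent for the action on $X$, with respect to every vertex $x_0$ of $X$ and every finite generating set $T$ of $G$. 2. Let $\mathcal H$ be a family of infinite-index subgroups of $G$ for which there is a constant $C$ such that every $H\in\mathcal H$ is quasi-convex in $\mathrm{Cay}(G,S)$ with constant $C$. Then the coned-off Cayley graph $X=\mathrm{Cay}(G,S\cup\bigcup_{H\in\mathcal H}H)$ is hyperbolic, and $G$ contains an element that is super-divergent for the action on $X$, with respect to every vertex $x_0$ of $X$ and every finite generating set $T$ of $G$. -/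

import Mathlib

open Filter

/-!
Graphs are regarded as metric spaces through their vertex set and the graph metric
`SimpleGraph.dist`; a path is a walk, and its length is its number of edges.  The Cayley graph of
`G` with respect to `U` is Mathlib's `SimpleGraph.mulCayley U` (`u` and `v` are joined when
`u ≠ v` and `v = u * s` or `u = v * s` for some `s ∈ U`), its graph metric is the word metric of
`U`, and `G` acts on it by left multiplication.
-/

/-- A walk is geodesic if its length is the distance between its endpoints. -/
def IsGeodesicWalk {X : Type*} (Γ : SimpleGraph X) {x y : X} (p : Γ.Walk x y) : Prop :=
  p.length = Γ.dist x y

/-- A connected graph is hyperbolic if, for some `δ > 0`, each side of any geodesic triangle is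
contained in the closed `δ`-neighbourhood of the union of the other two sides. -/
def IsHyperbolicGraph {X : Type*} (Γ : SimpleGraph X) : Prop :=
  Γ.Connected ∧
    ∃ δ : ℝ, 0 < δ ∧
      ∀ (x y z : X) (p : Γ.Walk x y) (q : Γ.Walk y z) (r : Γ.Walk x z),
        IsGeodesicWalk Γ p → IsGeodesicWalk Γ q → IsGeodesicWalk Γ r →
          ∀ v ∈ p.support, ∃ w, (w ∈ q.support ∨ w ∈ r.support) ∧ (Γ.dist v w : ℝ) ≤ δ

/-- A group is hyperbolic if it has a finite generating set whose Cayley graph is hyperbolic. -/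
def IsHyperbolicGroup (G : Type*) [Group G] : Prop :=
  ∃ S : Set G, S.Finite ∧ Subgroup.closure S = ⊤ ∧ IsHyperbolicGraph (SimpleGraph.mulCayley S)

/-- `A` is quasi-convex in `Γ` with constant `C`: all geodesics with endpoints in `A` are
contained in the closed `C`-neighbourhood of `A`. -/
def IsQuasiConvexWith {X : Type*} (Γ : SimpleGraph X) (C : ℝ) (A : Set X) : Prop :=
  ∀ x ∈ A, ∀ y ∈ A, ∀ p : Γ.Walk x y, IsGeodesicWalk Γ p →
    ∀ v ∈ p.support, ∃ a ∈ A, (Γ.dist v a : ℝ) ≤ C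

/-- The coned-off Cayley graph `Cay(G, S ∪ ⋃ 𝓗)` of `G` with respect to `S` over the family of
subgroups `𝓗`. -/
def conedOffCayley {G : Type*} [Group G] (S : Set G) (𝓗 : Set (Subgroup G)) : SimpleGraph G :=
  SimpleGraph.mulCayley (S ∪ ⋃ H ∈ 𝓗, (H : Set G))

/-- `G` acts on the hyperbolic graph `Γ` by graph automorphisms. -/
def ActsOnHyperbolicGraph (G : Type*) [Group G] {X : Type*} [MulAction G X]
    (Γ : SimpleGraph X) : Prop :=
  IsHyperbolicGraph Γ ∧ ∀ (h : G) (x y : X), Γ.Adj (h • x) (h • y) ↔ Γ.Adj x y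

/-- `g` acts loxodromically on `Γ`: the orbit maps `n ↦ g ^ n • x₀` from `ℤ` are quasi-isometric
embeddings. -/
def IsLoxodromic {G : Type*} [Group G] {X : Type*} [MulAction G X]
    (Γ : SimpleGraph X) (g : G) : Prop :=
  ∀ x₀ : X, ∃ a b : ℝ, 1 ≤ a ∧ 0 ≤ b ∧ ∀ m n : ℤ,
    |(m : ℝ) - n| / a - b ≤ (Γ.dist (g ^ m • x₀) (g ^ n • x₀) : ℝ) ∧
      (Γ.dist (g ^ m • x₀) (g ^ n • x₀) : ℝ) ≤ a * |(m : ℝ) - n| + b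

/-- A positive function on the positive reals growing faster than any linear function
(the values of `f` outside the positive reals are irrelevant). -/
def IsSuperlinear (f : ℝ → ℝ) : Prop :=
  (∀ t, 0 < t → 0 < f t) ∧ Tendsto (fun t => f t / t) atTop atTop

/-- `π` is a super-divergent projection onto `A`, with respect to the graph metric of `Γ`. -/
def IsSuperDivergentProjection {Z : Type*} (Γ : SimpleGraph Z) (A : Set Z) (π : Z → Z) : Prop :=
  (∀ z, π z ∈ A) ∧ (∀ a ∈ A, π a = a) ∧
    ∃ (θ : ℝ) (f : ℝ → ℝ), 0 < θ ∧ IsSuperlinear f ∧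
      ∀ d : ℝ, 0 < d → ∀ (x y : Z) (p : Γ.Walk x y),
        (∀ z ∈ p.support, ∀ a ∈ A, d < (Γ.dist z a : ℝ)) →
          θ < (Γ.dist (π x) (π y) : ℝ) → f d < (p.length : ℝ)

/-- `π : G → A` is an `X`-projection with basepoint `x₀`, where `X` is the vertex set of `Γ`:
for all `h`, the point `π h • x₀` is a closest point to `h • x₀` in `A • x₀`. -/
def IsXProjection {G : Type*} [Group G] {X : Type*} [MulAction G X]
    (Γ : SimpleGraph X) (x₀ : X) (A : Set G) (π : G → G) : Prop :=
  ∀ h, π h ∈ A ∧ ∀ a ∈ A, Γ.dist (h • x₀) (π h • x₀) ≤ Γ.dist (h • x₀) (a • x₀)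

/-- `g` is a super-divergent element for the action on `Γ`, with basepoint `x₀` and with `G`
endowed with the word metric of `T`: it is loxodromic, and `X`-projections onto `⟨g⟩` exist and
are super-divergent. -/
def IsSuperDivergentElement {G : Type*} [Group G] {X : Type*} [MulAction G X]
    (Γ : SimpleGraph X) (T : Set G) (x₀ : X) (g : G) : Prop :=
  IsLoxodromic Γ g ∧
    (∃ π : G → G, IsXProjection Γ x₀ (Subgroup.zpowers g : Set G) π) ∧
      ∀ π : G → G, IsXProjection Γ x₀ (Subgroup.zpowers g : Set G) π →
        IsSuperDivergentProjection (SimpleGraph.mulCayley T) (Subgroup.zpowers g : Set G) π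

/-- `G` acts on the hyperbolic graph `Γ` with a super-divergent element; the element does not
depend on the choice of the word metric on `G` and of the basepoint. -/
def HasSuperDivergentElement (G : Type*) [Group G] {X : Type*} [MulAction G X]
    (Γ : SimpleGraph X) : Prop :=
  ActsOnHyperbolicGraph G Γ ∧
    ∃ g : G, ∀ T : Set G, T.Finite → Subgroup.closure T = ⊤ → ∀ x₀ : X,
      IsSuperDivergentElement Γ T x₀ g

/-!
The Cayley graph of `S` is the coned-off graph over the empty family, so only coned-off graphs `X`
have to be treated.

*Hyperbolicity.*  Let `Γ₀` be hyperbolic, and let `Γ` be a second graph on the same vertices, such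
that the identity `Γ₀ → Γ` is Lipschitz and `Γ₀`-geodesics between `Γ`-adjacent vertices have
bounded `Γ`-diameter (`Comparison`).  By repeated halving, a `Γ₀`-geodesic is at `Γ`-distance at
most logarithmic in `n` from every `Γ`-path of length `n` with the same ends (`exists_dist_le_log`).
So the usual proof of the Morse lemma applies (`Comparison.morse`): `Γ₀`-geodesics and `Γ`-geodesics
with the same ends are `Γ`-close, and `Γ` is hyperbolic.  This covers the passage from one finite
generating set to another, and, as the subgroups in `𝓗` are uniformly quasi-convex, the passage from
`Cay(G, T)` to `X`.

*Loxodromic elements.*  If an invariant hyperbolic graph on `G` is unbounded, then the ends `a` and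
`b` of a long geodesic centered at `1` give an element `w` among `a`, `b`, `a⁻¹ * b` whose square is
much longer than itself (`exists_isStraight`), and the four-point condition implies that the length
of `w ^ n` grows linearly.  To see that `X` is unbounded (`exists_dist_gt`), note that uniform
quasi-convexity makes `𝓗` finite, and that by B. H. Neumann's lemma `G` is not a finite union of
cosets of subgroups of infinite index.  In `Cay(G, S)`, the shadow of an element of `G` seen from
`1` is not contained in such a union either (`exists_not_isCosetSmall_shadow`); this uses that
`Cay(G, S)`, which is infinite and locally finite, has a loxodromic element.  So, given `u`, there
is `v` deep in its shadow such that no coset of a member of `𝓗` comes close to both `u` and `v`.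
Then a point in the shadow of `v` cannot be joined by an edge of `X` to a point outside the shadow
of `u`, and iterating this produces points arbitrarily far from `1` in `X`.

*Super-divergence.*  Let `π` be an `X`-projection onto the powers of `w`.  As `w` is loxodromic on
`X`, its powers form a quasi-geodesic in `Cay(G, T)`.  If `π x` and `π y` are far apart, then the
middle of a `Cay(G, T)`-geodesic between them is close to a power of `w`, and it is close to a
geodesic from `x` to `y`, because a geodesic from `x` to `π x` can be close to powers of `w` only
near `π x` (`exists_dist_projection_le`).  By the logarithmic estimate, a path from `x` to `y` at
distance `d` from the powers of `w` has length exponential in `d`.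
-/

namespace SimpleGraph

variable {V : Type*} {Γ : SimpleGraph V}

/-! ### Intervals and slim triangles -/

/-- The union of all geodesics from `x` to `y`.  Working with intervals instead of geodesic walks
turns statements about geodesics into linear arithmetic of distances. -/
def geodInterval (Γ : SimpleGraph V) (x y : V) : Set V :=
  {v | Γ.dist x v + Γ.dist v y = Γ.dist x y}

theorem mem_geodInterval {x y v : V} :
    v ∈ Γ.geodInterval x y ↔ Γ.dist x v + Γ.dist v y = Γ.dist x y := Iff.rfl

theorem right_mem_geodInterval (x y : V) : y ∈ Γ.geodInterval x y := by
  simp [mem_geodInterval]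

theorem geodInterval_comm (x y : V) : Γ.geodInterval x y = Γ.geodInterval y x := by
  ext v
  rw [mem_geodInterval, mem_geodInterval, Γ.dist_comm (u := x) (v := v),
    Γ.dist_comm (u := v) (v := y), Γ.dist_comm (u := x) (v := y), add_comm]

theorem Connected.mem_geodInterval_of_isGeodesicWalk (hΓ : Γ.Connected) {x y v : V}
    {p : Γ.Walk x y} (hp : IsGeodesicWalk Γ p) (hv : v ∈ p.support) : v ∈ Γ.geodInterval x y := by
  classical
  have h1 := Γ.dist_le (p.takeUntil v hv)
  have h2 := Γ.dist_le (p.dropUntil v hv)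
  have h3 := congrArg Walk.length (p.take_spec hv)
  have h4 := hΓ.dist_triangle (u := x) (v := v) (w := y)
  rw [Walk.length_append] at h3
  rw [IsGeodesicWalk] at hp
  rw [mem_geodInterval]
  omega

theorem Connected.exists_isGeodesicWalk (hΓ : Γ.Connected) (x y : V) :
    ∃ p : Γ.Walk x y, IsGeodesicWalk Γ p :=
  hΓ.exists_walk_length_eq_dist x y

theorem Connected.exists_isGeodesicWalk_mem (hΓ : Γ.Connected) {x y v : V}
    (hv : v ∈ Γ.geodInterval x y) :
    ∃ p : Γ.Walk x y, IsGeodesicWalk Γ p ∧ v ∈ p.support := by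
  obtain ⟨p, hp⟩ := hΓ.exists_isGeodesicWalk x v
  obtain ⟨q, hq⟩ := hΓ.exists_isGeodesicWalk v y
  refine ⟨p.append q, ?_, by simp [Walk.mem_support_append_iff]⟩
  rw [IsGeodesicWalk, Walk.length_append, hp, hq]
  exact hv

/-- A geodesic walk contains a vertex at each distance from its starting point. -/
theorem Connected.exists_mem_support_dist_eq (hΓ : Γ.Connected) {x y : V} {p : Γ.Walk x y}
    (hp : IsGeodesicWalk Γ p) {k : ℕ} (hk : k ≤ Γ.dist x y) :
    ∃ v ∈ p.support, Γ.dist x v = k := by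
  refine ⟨p.getVert k, p.getVert_mem_support k, ?_⟩
  have h1 := Γ.dist_le (p.take k)
  have h2 := Γ.dist_le (p.drop k)
  have h4 := hΓ.dist_triangle (u := x) (v := p.getVert k) (w := y)
  rw [Walk.take_length] at h1
  rw [Walk.drop_length] at h2
  rw [IsGeodesicWalk] at hp
  omega

theorem Connected.exists_mem_geodInterval_dist_eq (hΓ : Γ.Connected) {x y : V} {k : ℕ}
    (hk : k ≤ Γ.dist x y) : ∃ v ∈ Γ.geodInterval x y, Γ.dist x v = k := by
  obtain ⟨p, hp⟩ := hΓ.exists_isGeodesicWalk x y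
  obtain ⟨v, hv, h⟩ := hΓ.exists_mem_support_dist_eq hp hk
  exact ⟨v, hΓ.mem_geodInterval_of_isGeodesicWalk hp hv, h⟩

/-- Intervals are geodesically convex in the weak sense that they contain the intervals from their
points to their ends. -/
theorem Connected.geodInterval_subset_left (hΓ : Γ.Connected) {x y z : V}
    (hz : z ∈ Γ.geodInterval x y) : Γ.geodInterval x z ⊆ Γ.geodInterval x y := by
  intro v hv
  have h1 := hΓ.dist_triangle (u := v) (v := z) (w := y)
  have h2 := hΓ.dist_triangle (u := x) (v := v) (w := y)
  rw [mem_geodInterval] at *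
  omega

/-- Geodesic triangles are `δ`-slim, in terms of intervals. -/
def Slim (Γ : SimpleGraph V) (δ : ℕ) : Prop :=
  ∀ x y z v : V, v ∈ Γ.geodInterval x y →
    ∃ w, (w ∈ Γ.geodInterval x z ∨ w ∈ Γ.geodInterval z y) ∧ Γ.dist v w ≤ δ

/-- Two points at the same distance from `x` on geodesics from `x` to `y` are close. -/
theorem Slim.dist_le_of_mem_geodInterval {δ : ℕ} (h : Γ.Slim δ) (hΓ : Γ.Connected) {x y v w : V}
    (hv : v ∈ Γ.geodInterval x y) (hw : w ∈ Γ.geodInterval x y) (hvw : Γ.dist x v = Γ.dist x w) :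
    Γ.dist v w ≤ 2 * δ := by
  obtain ⟨t, ht, htv⟩ := h x y w v hv
  have h1 := hΓ.dist_triangle (u := v) (v := t) (w := w)
  rw [mem_geodInterval] at hv hw
  rcases ht with ht | ht
  · rw [mem_geodInterval] at ht
    have h2 := hΓ.dist_triangle (u := x) (v := t) (w := v)
    rw [Γ.dist_comm (u := t) (v := v)] at h2
    omega
  · rw [mem_geodInterval] at ht
    have h3 := hΓ.dist_triangle (u := v) (v := t) (w := y)
    have h4 : Γ.dist t v = Γ.dist v t := Γ.dist_comm
    have h5 : Γ.dist w t = Γ.dist t w := Γ.dist_comm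
    omega

theorem exists_slim_of_isHyperbolicGraph (h : IsHyperbolicGraph Γ) :
    ∃ δ : ℕ, Γ.Slim δ := by
  obtain ⟨hΓ, δ, hδ, h⟩ := h
  refine ⟨⌈δ⌉₊, fun x y z v hv => ?_⟩
  obtain ⟨p, hp, hvp⟩ := hΓ.exists_isGeodesicWalk_mem hv
  obtain ⟨q, hq⟩ := hΓ.exists_isGeodesicWalk y z
  obtain ⟨r, hr⟩ := hΓ.exists_isGeodesicWalk x z
  obtain ⟨w, hw, hvw⟩ := h x y z p q r hp hq hr v hvp
  refine ⟨w, ?_, by exact_mod_cast hvw.trans (Nat.le_ceil δ)⟩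
  rcases hw with hw | hw
  · right
    rw [geodInterval_comm]
    exact hΓ.mem_geodInterval_of_isGeodesicWalk hq hw
  · exact Or.inl (hΓ.mem_geodInterval_of_isGeodesicWalk hr hw)

theorem Slim.isHyperbolicGraph {δ : ℕ} (h : Γ.Slim δ) (hΓ : Γ.Connected) :
    IsHyperbolicGraph Γ := by
  refine ⟨hΓ, 3 * δ + 1, by positivity, fun x y z p q r hp hq hr v hv => ?_⟩
  obtain ⟨w, hw, hvw⟩ := h x y z v (hΓ.mem_geodInterval_of_isGeodesicWalk hp hv)
  -- A point of an interval is close to any given geodesic between its ends.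
  have key : ∀ {a b : V} (s : Γ.Walk a b), IsGeodesicWalk Γ s → w ∈ Γ.geodInterval a b →
      ∃ u ∈ s.support, (Γ.dist v u : ℝ) ≤ 3 * δ + 1 := by
    intro a b s hs hw
    have hle : Γ.dist a w ≤ Γ.dist a b := by rw [mem_geodInterval] at hw; omega
    obtain ⟨u, hu, hau⟩ := hΓ.exists_mem_support_dist_eq hs hle
    have h1 := h.dist_le_of_mem_geodInterval hΓ hw
      (hΓ.mem_geodInterval_of_isGeodesicWalk hs hu) hau.symm
    have h2 := hΓ.dist_triangle (u := v) (v := w) (w := u)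
    refine ⟨u, hu, ?_⟩
    have h3 : Γ.dist v u ≤ 3 * δ + 1 := by omega
    exact_mod_cast h3
  rcases hw with hw | hw
  · obtain ⟨u, hu, h1⟩ := key r hr hw
    exact ⟨u, Or.inr hu, h1⟩
  · rw [geodInterval_comm] at hw
    obtain ⟨u, hu, h1⟩ := key q hq hw
    exact ⟨u, Or.inl hu, h1⟩

theorem Slim.quadrilateral {δ : ℕ} (h : Γ.Slim δ) (hΓ : Γ.Connected) {x a b y v : V}
    (hv : v ∈ Γ.geodInterval x y) :
    ∃ w, (w ∈ Γ.geodInterval x a ∨ w ∈ Γ.geodInterval a b ∨ w ∈ Γ.geodInterval b y) ∧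
      Γ.dist v w ≤ 2 * δ := by
  obtain ⟨w, hw | hw, hvw⟩ := h x y a v hv
  · exact ⟨w, Or.inl hw, by omega⟩
  · obtain ⟨u, hu, hwu⟩ := h a y b w hw
    have := hΓ.dist_triangle (u := v) (v := w) (w := u)
    exact ⟨u, Or.inr hu, by omega⟩

/-- The four-point condition, an inequality between the three pairings of four points. -/
def FourPoint (Γ : SimpleGraph V) (δ : ℕ) : Prop :=
  ∀ x y z w : V, Γ.dist x z + Γ.dist y w ≤
    max (Γ.dist x y + Γ.dist z w) (Γ.dist y z + Γ.dist x w) + δ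

/-- Some point of a geodesic from `x` to `y` is, up to a constant, as close to `w` as the Gromov
product of `x` and `y` based at `w`. -/
theorem Slim.exists_mem_geodInterval_dist_le {δ : ℕ} (h : Γ.Slim δ) (hΓ : Γ.Connected)
    (x y w : V) : ∃ m ∈ Γ.geodInterval x y,
      2 * Γ.dist w m + Γ.dist x y ≤ Γ.dist w x + Γ.dist w y + (4 * δ + 4) := by
  obtain ⟨p, hp⟩ := hΓ.exists_isGeodesicWalk x y
  -- The first vertex of the geodesic that is close to a geodesic from `w` to `y`.
  let P : ℕ → Prop := fun k => ∃ t ∈ Γ.geodInterval w y, Γ.dist (p.getVert k) t ≤ δ + 1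
  have hP : ∃ k, P k := ⟨p.length, y, right_mem_geodInterval w y, by simp⟩
  classical
  have hk := Nat.find_spec hP
  have hmin := fun m => Nat.find_min hP (m := m)
  set k := Nat.find hP
  have hmem : ∀ j, p.getVert j ∈ Γ.geodInterval x y := fun j =>
    hΓ.mem_geodInterval_of_isGeodesicWalk hp (p.getVert_mem_support j)
  have hx : ∃ s ∈ Γ.geodInterval w x, Γ.dist (p.getVert k) s ≤ δ + 1 := by
    rcases Nat.eq_zero_or_pos k with h0 | h0
    · exact ⟨x, right_mem_geodInterval w x, by rw [h0]; simp⟩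
    · obtain ⟨s, hs | hs, hd⟩ := h x y w (p.getVert (k - 1)) (hmem _)
      · refine ⟨s, by rwa [geodInterval_comm], ?_⟩
        have h1 : Γ.dist (p.getVert k) (p.getVert (k - 1)) ≤ 1 := by
          by_cases hlt : k - 1 < p.length
          · have := p.adj_getVert_succ hlt
            rw [Nat.sub_add_cancel h0] at this
            exact (dist_eq_one_iff_adj.mpr this.symm).le
          · rw [p.getVert_of_length_le (i := k) (by omega),
              p.getVert_of_length_le (i := k - 1) (by omega)]
            simp
        have h2 := hΓ.dist_triangle (u := p.getVert k) (v := p.getVert (k - 1)) (w := s)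
        omega
      · exact absurd ⟨s, hs, by omega⟩ (hmin (k - 1) (by omega))
  obtain ⟨t, ht, htd⟩ := hk
  obtain ⟨s, hs, hsd⟩ := hx
  have hm := hmem k
  refine ⟨p.getVert k, hm, ?_⟩
  set m := p.getVert k
  have h1 := hΓ.dist_triangle (u := w) (v := t) (w := m)
  have h2 := hΓ.dist_triangle (u := w) (v := s) (w := m)
  have h3 := hΓ.dist_triangle (u := m) (v := t) (w := y)
  have h4 := hΓ.dist_triangle (u := m) (v := s) (w := x)
  have h5 : Γ.dist t m = Γ.dist m t := Γ.dist_comm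
  have h6 : Γ.dist s m = Γ.dist m s := Γ.dist_comm
  have h7 : Γ.dist x m = Γ.dist m x := Γ.dist_comm
  rw [mem_geodInterval] at *
  omega

theorem Connected.dist_add_dist_le_of_mem_geodInterval (hΓ : Γ.Connected) {x y m : V}
    (hm : m ∈ Γ.geodInterval x y) (w : V) :
    Γ.dist w x + Γ.dist w y ≤ 2 * Γ.dist w m + Γ.dist x y := by
  have h1 := hΓ.dist_triangle (u := w) (v := m) (w := x)
  have h2 := hΓ.dist_triangle (u := w) (v := m) (w := y)
  have h3 : Γ.dist x m = Γ.dist m x := Γ.dist_comm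
  rw [mem_geodInterval] at hm
  omega

theorem Slim.fourPoint {δ : ℕ} (h : Γ.Slim δ) (hΓ : Γ.Connected) : Γ.FourPoint (6 * δ + 4) := by
  intro x y z w
  obtain ⟨m, hm, hwm⟩ := h.exists_mem_geodInterval_dist_le hΓ x z w
  obtain ⟨t, ht, hmt⟩ := h x z y m hm
  have h1 := hΓ.dist_triangle (u := w) (v := m) (w := t)
  have e1 : Γ.dist w x = Γ.dist x w := Γ.dist_comm
  have e2 : Γ.dist w y = Γ.dist y w := Γ.dist_comm
  have e3 : Γ.dist w z = Γ.dist z w := Γ.dist_comm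
  rcases ht with ht | ht
  · have := hΓ.dist_add_dist_le_of_mem_geodInterval ht w
    omega
  · have := hΓ.dist_add_dist_le_of_mem_geodInterval ht w
    omega

end SimpleGraph

namespace SimpleGraph

variable {V : Type*} {Γ Γ₀ : SimpleGraph V}

/-! ### Stability of geodesics under a change of graph -/

/-- Two graph structures on the same vertex set are compared: the identity is `K`-Lipschitz from
`Γ₀` to `Γ`, and `Γ₀`-geodesics between `Γ`-adjacent vertices have `Γ`-diameter at most `2 * K`. -/
structure Comparison (Γ₀ Γ : SimpleGraph V) (K : ℕ) : Prop where
  connected₀ : Γ₀.Connected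
  connected : Γ.Connected
  dist_le_of_adj : ∀ {x y : V}, Γ₀.Adj x y → Γ.dist x y ≤ K
  dist_le_of_mem : ∀ {x y v : V}, Γ.Adj x y → v ∈ Γ₀.geodInterval x y → Γ.dist x v ≤ K

theorem Connected.dist_le_mul_length (hΓ : Γ.Connected) {K : ℕ}
    (h : ∀ {x y : V}, Γ₀.Adj x y → Γ.dist x y ≤ K) {x y : V} (p : Γ₀.Walk x y) :
    Γ.dist x y ≤ K * p.length := by
  induction p with
  | nil => simp
  | @cons u v w hadj p ih =>
    have h1 := hΓ.dist_triangle (u := u) (v := v) (w := w)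
    have h2 := h hadj
    rw [Walk.length_cons, mul_add]
    omega

theorem Connected.dist_le_mul_dist (hΓ : Γ.Connected) (hΓ₀ : Γ₀.Connected) {K : ℕ}
    (h : ∀ {x y : V}, Γ₀.Adj x y → Γ.dist x y ≤ K) (x y : V) :
    Γ.dist x y ≤ K * Γ₀.dist x y := by
  obtain ⟨p, hp⟩ := hΓ₀.exists_walk_length_eq_dist x y
  exact hp ▸ hΓ.dist_le_mul_length h p

theorem Walk.dist_getVert_succ_le {x y : V} (p : Γ.Walk x y) (i : ℕ) :
    Γ.dist (p.getVert i) (p.getVert (i + 1)) ≤ 1 := by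
  by_cases hlt : i < p.length
  · exact (dist_eq_one_iff_adj.mpr (p.adj_getVert_succ hlt)).le
  · rw [p.getVert_of_length_le (i := i) (by omega),
      p.getVert_of_length_le (i := i + 1) (by omega)]
    simp

theorem Connected.dist_getVert (hΓ : Γ.Connected) {x y : V} {p : Γ.Walk x y}
    (hp : IsGeodesicWalk Γ p) {i j : ℕ} (hij : i ≤ j) (hj : j ≤ p.length) :
    Γ.dist (p.getVert i) (p.getVert j) = j - i := by
  have h1 := Γ.dist_le (p.take i)
  have h2 := Γ.dist_le (p.drop j)
  have h3 := Γ.dist_le (((p.drop i).take (j - i)).copy rfl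
    (by rw [Walk.drop_getVert]; congr 1; omega) : Γ.Walk (p.getVert i) (p.getVert j))
  have h4 := hΓ.dist_triangle (u := x) (v := p.getVert i) (w := y)
  have h5 := hΓ.dist_triangle (u := p.getVert i) (v := p.getVert j) (w := y)
  rw [Walk.take_length] at h1
  rw [Walk.drop_length] at h2
  rw [Walk.length_copy, Walk.take_length, Walk.drop_length] at h3
  rw [IsGeodesicWalk] at hp
  omega

theorem Comparison.dist_le {K : ℕ} (h : Comparison Γ₀ Γ K) (x y : V) :
    Γ.dist x y ≤ K * Γ₀.dist x y :=
  h.connected.dist_le_mul_dist h.connected₀ h.dist_le_of_adj x y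

theorem Connected.eq_of_mem_geodInterval_self (hΓ : Γ.Connected) {x v : V}
    (hv : v ∈ Γ.geodInterval x x) : v = x := by
  rw [mem_geodInterval, dist_self] at hv
  exact (hΓ.dist_eq_zero_iff.mp (by omega : Γ.dist x v = 0)).symm

/-- A `Γ₀`-geodesic lies at `Γ`-distance at most logarithmic in the number of steps from any
sequence of points with the same ends: halve the sequence and use slimness. -/
theorem Comparison.exists_dist_le_log {K δ B : ℕ} (h : Comparison Γ₀ Γ K) (hδ : Γ₀.Slim δ)
    {q : ℕ → V} (hq : ∀ i, ∀ v ∈ Γ₀.geodInterval (q i) (q (i + 1)), Γ.dist v (q i) ≤ B) (m : ℕ) :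
    ∀ ⦃a b : ℕ⦄, a ≤ b → b ≤ a + 2 ^ m → ∀ ⦃z : V⦄, z ∈ Γ₀.geodInterval (q a) (q b) →
      ∃ i, a ≤ i ∧ i ≤ b ∧ Γ.dist z (q i) ≤ K * δ * m + B := by
  induction m with
  | zero =>
    intro a b hab hb z hz
    rw [pow_zero] at hb
    rcases (by omega : b = a ∨ b = a + 1) with rfl | rfl
    · rw [h.connected₀.eq_of_mem_geodInterval_self hz]
      exact ⟨b, le_rfl, le_rfl, by simp⟩
    · exact ⟨a, le_rfl, hab, by simpa using hq a z hz⟩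
  | succ m ih =>
    intro a b hab hb z hz
    rw [pow_succ] at hb
    obtain ⟨c, hac, hcb, hc1, hc2⟩ : ∃ c, a ≤ c ∧ c ≤ b ∧ c ≤ a + 2 ^ m ∧ b ≤ c + 2 ^ m :=
      ⟨a + (b - a) / 2, by omega, by omega, by omega, by omega⟩
    obtain ⟨w, hw, hzw⟩ := hδ _ _ (q c) z hz
    have h1 := h.dist_le z w
    have h2 : K * Γ₀.dist z w ≤ K * δ := Nat.mul_le_mul_left K hzw
    have h3 : K * δ * (m + 1) = K * δ * m + K * δ := by ring
    rcases hw with hw | hw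
    · obtain ⟨i, hi1, hi2, hi⟩ := ih hac hc1 hw
      have := h.connected.dist_triangle (u := z) (v := w) (w := q i)
      exact ⟨i, hi1, by omega, by omega⟩
    · obtain ⟨i, hi1, hi2, hi⟩ := ih hcb hc2 hw
      have := h.connected.dist_triangle (u := z) (v := w) (w := q i)
      exact ⟨i, by omega, hi2, by omega⟩

theorem Comparison.dist_le_of_mem_of_dist_le_one {K : ℕ} (h : Comparison Γ₀ Γ K) {x y v : V}
    (hxy : Γ.dist x y ≤ 1) (hv : v ∈ Γ₀.geodInterval x y) : Γ.dist v x ≤ K := by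
  rw [dist_comm]
  rcases (by omega : Γ.dist x y = 0 ∨ Γ.dist x y = 1) with h0 | h1
  · obtain rfl := h.connected.dist_eq_zero_iff.mp h0
    rw [h.connected₀.eq_of_mem_geodInterval_self hv]
    simp
  · exact h.dist_le_of_mem (dist_eq_one_iff_adj.mp h1) hv

theorem Comparison.exists_mem_support_dist_le {K δ : ℕ} (h : Comparison Γ₀ Γ K) (hδ : Γ₀.Slim δ)
    {x y z : V} (p : Γ.Walk x y) {m : ℕ} (hm : p.length ≤ 2 ^ m) (hz : z ∈ Γ₀.geodInterval x y) :
    ∃ t ∈ p.support, Γ.dist z t ≤ K * δ * m + K := by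
  have hz' : z ∈ Γ₀.geodInterval (p.getVert 0) (p.getVert p.length) := by simpa using hz
  obtain ⟨i, -, -, hi⟩ := h.exists_dist_le_log hδ
    (fun i v hv => h.dist_le_of_mem_of_dist_le_one (p.dist_getVert_succ_le i) hv) m
    (Nat.zero_le p.length) (by omega) hz'
  exact ⟨_, p.getVert_mem_support i, hi⟩

theorem Comparison.exists_mem_geodInterval_dist_le_log {K δ : ℕ} (h : Comparison Γ₀ Γ K)
    (hδ : Γ₀.Slim δ) {x y z : V} {m : ℕ} (hm : Γ.dist x y ≤ 2 ^ m)
    (hz : z ∈ Γ₀.geodInterval x y) :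
    ∃ t ∈ Γ.geodInterval x y, Γ.dist z t ≤ K * δ * m + K := by
  obtain ⟨p, hp⟩ := h.connected.exists_isGeodesicWalk x y
  obtain ⟨t, ht, hzt⟩ := h.exists_mem_support_dist_le hδ p (hp.trans_le hm) hz
  exact ⟨t, h.connected.mem_geodInterval_of_isGeodesicWalk hp ht, hzt⟩

theorem Comparison.exists_dist_le_of_mem {K δ : ℕ} (h : Comparison Γ₀ Γ K) (hδ : Γ₀.Slim δ)
    (L : ℕ) : ∃ B, ∀ {x y v : V}, Γ.dist x y ≤ L → v ∈ Γ₀.geodInterval x y → Γ.dist v x ≤ B := by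
  refine ⟨K * δ * L + K + L, fun {x y v} hxy hv => ?_⟩
  obtain ⟨t, ht, hvt⟩ := h.exists_mem_geodInterval_dist_le_log hδ
    (hxy.trans Nat.lt_two_pow_self.le) hv
  have h1 := h.connected.dist_triangle (u := v) (v := t) (w := x)
  have h2 : Γ.dist t x = Γ.dist x t := dist_comm
  rw [mem_geodInterval] at ht
  omega

/-- A number that is at most logarithmic in itself is bounded. -/
theorem exists_bound_of_le_log (A B : ℕ) :
    ∃ R : ℕ, ∀ D : ℕ, (∀ m, B * (D + 1) ≤ 2 ^ m → D ≤ A * (m + 1)) → D ≤ R := by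
  have hlim : Tendsto (fun m : ℕ => ((m : ℝ) ^ 1) / (2 : ℝ) ^ m) atTop (nhds 0) :=
    tendsto_pow_const_div_const_pow_of_one_lt 1 one_lt_two
  set c : ℝ := B * (3 * A + 1) + 1 with hc
  have hcpos : 0 < c := by positivity
  obtain ⟨m₀, hm₀⟩ := (hlim.eventually (gt_mem_nhds (inv_pos.mpr hcpos))).exists_forall_of_atTop
  have hpow : ∀ m, m₀ ≤ m → 1 ≤ m → B * (A * (m + 2) + 1) ≤ 2 ^ m := by
    intro m hm hm1
    have h1 := hm₀ m hm
    rw [pow_one, div_lt_iff₀ (by positivity), inv_mul_eq_div, lt_div_iff₀ hcpos] at h1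
    have h2 : B * (A * (m + 2) + 1) ≤ m * (B * (3 * A + 1)) := by
      have h3 : A * (m + 2) + 1 ≤ m * (3 * A + 1) := by nlinarith
      calc B * (A * (m + 2) + 1) ≤ B * (m * (3 * A + 1)) := Nat.mul_le_mul_left B h3
        _ = _ := by ring
    have h4 : (m : ℝ) * (B * (3 * A + 1)) ≤ 2 ^ m := by
      rw [hc] at h1
      nlinarith [(Nat.cast_nonneg m : (0 : ℝ) ≤ m)]
    exact h2.trans (by exact_mod_cast h4)
  refine ⟨A * (m₀ + 3), fun D hD => ?_⟩
  by_contra! hlt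
  -- Take the first `m` for which `A * (m + 2)` reaches `D`.
  rcases Nat.eq_zero_or_pos A with rfl | hA
  · have := hD (B * (D + 1)) Nat.lt_two_pow_self.le
    omega
  have hex : ∃ m, D ≤ A * (m + 2) := ⟨D, by nlinarith⟩
  classical
  have h1 := Nat.find_spec hex
  have h2 := fun m => Nat.find_min hex (m := m)
  set m := Nat.find hex
  have hm : m₀ + 1 < m := by
    by_contra! hle
    have : A * (m + 2) ≤ A * (m₀ + 3) := Nat.mul_le_mul_left A (by omega)
    omega
  have h3 := h2 (m - 1) (by omega)
  have h4 := hD m ((Nat.mul_le_mul_left B (by omega)).trans (hpow m (by omega) (by omega)))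
  rw [show m - 1 + 2 = m + 1 by omega] at h3
  omega

/-- Following a `Γ₀`-geodesic from `z` to `x`, one meets a point at `Γ`-distance about `M` from `z`,
unless one reaches `x` before. -/
theorem Comparison.exists_mem_geodInterval_dist_ge {K : ℕ} (h : Comparison Γ₀ Γ K) (z x : V)
    (M : ℕ) : ∃ x₁ ∈ Γ₀.geodInterval z x,
      Γ.dist z x₁ ≤ M + K ∧ (M ≤ Γ.dist z x₁ ∨ x₁ = x) := by
  obtain ⟨p, hp⟩ := h.connected₀.exists_isGeodesicWalk z x
  have hex : ∃ k, M ≤ Γ.dist z (p.getVert k) ∨ p.getVert k = x := ⟨p.length, by simp⟩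
  classical
  have h1 := Nat.find_spec hex
  have h2 := fun m => Nat.find_min hex (m := m)
  set k := Nat.find hex
  refine ⟨p.getVert k, h.connected₀.mem_geodInterval_of_isGeodesicWalk hp
    (p.getVert_mem_support k), ?_, h1⟩
  rcases Nat.eq_zero_or_pos k with h0 | h0
  · rw [h0]; simp
  · have h3 := h2 (k - 1) (by omega)
    have h4 := p.dist_getVert_succ_le (k - 1)
    rw [Nat.sub_add_cancel h0] at h4
    have h5 := h.dist_le (p.getVert (k - 1)) (p.getVert k)
    have h6 := h.connected.dist_triangle (u := z) (v := p.getVert (k - 1)) (w := p.getVert k)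
    have h7 : K * Γ₀.dist (p.getVert (k - 1)) (p.getVert k) ≤ K * 1 := Nat.mul_le_mul_left K h4
    omega

/-- **Morse lemma**: `Γ₀`-geodesics stay `Γ`-close to the `Γ`-quasi-geodesics with the same ends. -/
theorem Comparison.morse {K δ : ℕ} (h : Comparison Γ₀ Γ K) (hδ : Γ₀.Slim δ) (L c : ℕ) :
    ∃ R, ∀ (q : ℕ → V) (n : ℕ), (∀ i, Γ.dist (q i) (q (i + 1)) ≤ L) →
      (∀ i j, i ≤ j → j ≤ n → j ≤ i + c * (Γ.dist (q i) (q j) + 1)) →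
        ∀ z ∈ Γ₀.geodInterval (q 0) (q n), ∃ i ≤ n, Γ.dist z (q i) ≤ R := by
  obtain ⟨B, hB⟩ := h.exists_dist_le_of_mem hδ L
  obtain ⟨R, hR⟩ := exists_bound_of_le_log (3 * (K * δ) + K + B) (c * (2 * K + 7) + 1)
  refine ⟨R, fun q n hqL hqc => ?_⟩
  have hlog := fun m => h.exists_dist_le_log hδ (q := q) (fun i v hv => hB (hqL i) hv) m
  have hex : ∃ D, ∀ z ∈ Γ₀.geodInterval (q 0) (q n), ∃ i ≤ n, Γ.dist z (q i) ≤ D := by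
    refine ⟨K * δ * n + B, fun z hz => ?_⟩
    obtain ⟨i, -, hi, hd⟩ := hlog n (Nat.zero_le n) (by simpa using Nat.lt_two_pow_self.le) hz
    exact ⟨i, hi, hd⟩
  -- `D` is the largest distance to `q` of a point of the interval, and `z` realizes it.
  classical
  have hD := Nat.find_spec hex
  have hmin := fun m => Nat.find_min hex (m := m)
  set D := Nat.find hex
  suffices D ≤ R from fun z hz => by
    obtain ⟨i, hi, hd⟩ := hD z hz
    exact ⟨i, hi, hd.trans this⟩
  rcases Nat.eq_zero_or_pos D with h0 | hDpos
  · omega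
  have hz := hmin (D - 1) (by omega)
  push Not at hz
  obtain ⟨z, hz, hzq⟩ := hz
  have hzq : ∀ i ≤ n, D ≤ Γ.dist z (q i) := fun i hi => by have := hzq i hi; omega
  apply hR
  intro m hm
  have hABm : 2 * (K * δ) + (K * δ * m + (K + B)) ≤ (3 * (K * δ) + K + B) * (m + 1) := by
    nlinarith [Nat.zero_le (K * δ * m), Nat.zero_le (K * m), Nat.zero_le (B * m)]
  -- Points on both sides of `z`, at distance about `2 * D` from it, and their neighbours on `q`.
  have side : ∀ k ≤ n, Γ₀.geodInterval z (q k) ⊆ Γ₀.geodInterval (q 0) (q n) →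
      ∃ x₁ ∈ Γ₀.geodInterval z (q k), ∃ i ≤ n, Γ.dist z x₁ ≤ 2 * D + K ∧
        Γ.dist x₁ (q i) ≤ D ∧ (2 * D ≤ Γ.dist z x₁ ∨ x₁ = q i) := by
    intro k hk hsub
    obtain ⟨x₁, hx₁, hd, hor⟩ := h.exists_mem_geodInterval_dist_ge z (q k) (2 * D)
    rcases hor with hor | rfl
    · obtain ⟨i, hi, hxi⟩ := hD x₁ (hsub hx₁)
      exact ⟨x₁, hx₁, i, hi, hd, hxi, Or.inl hor⟩
    · exact ⟨q k, hx₁, k, hk, hd, by simp, Or.inr rfl⟩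
  -- The short sides: a point close to `z` cannot be too close to them.
  have short : ∀ {x₁ w : V} {i : ℕ}, i ≤ n → Γ.dist x₁ (q i) ≤ D →
      (2 * D ≤ Γ.dist z x₁ ∨ x₁ = q i) → w ∈ Γ₀.geodInterval x₁ (q i) →
        Γ.dist z w ≤ 2 * (K * δ) → D ≤ 2 * (K * δ) + (K * δ * m + (K + B)) := by
    intro x₁ w i hi hxi hor hw hzw
    rcases hor with hor | rfl
    · have hle : D ≤ 2 ^ m := by
        exact ((Nat.le_succ D).trans (Nat.le_mul_of_pos_left _ (Nat.succ_pos _))).trans hm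
      obtain ⟨t, ht, hwt⟩ := h.exists_mem_geodInterval_dist_le_log hδ (hxi.trans hle) hw
      have h1 := h.connected.dist_triangle (u := z) (v := w) (w := t)
      have h2 := h.connected.dist_triangle (u := z) (v := t) (w := x₁)
      have h3 : Γ.dist x₁ t = Γ.dist t x₁ := dist_comm
      rw [mem_geodInterval] at ht
      omega
    · rw [h.connected₀.eq_of_mem_geodInterval_self hw] at hzw
      have := hzq i hi
      omega
  have long : ∀ {i j : ℕ} {w : V}, i ≤ n → j ≤ n → Γ.dist (q i) (q j) ≤ 6 * D + 2 * K →
      i ≤ j → w ∈ Γ₀.geodInterval (q i) (q j) → Γ.dist z w ≤ 2 * (K * δ) →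
        D ≤ 2 * (K * δ) + (K * δ * m + (K + B)) := by
    intro i j w hi hj hd hij hw hzw
    have h1 : j ≤ i + 2 ^ m := by
      have h2 := hqc i j hij hj
      have h3 : c * (Γ.dist (q i) (q j) + 1) ≤ c * ((2 * K + 7) * (D + 1)) :=
        Nat.mul_le_mul_left c (by nlinarith)
      have h4 : c * ((2 * K + 7) * (D + 1)) ≤ (c * (2 * K + 7) + 1) * (D + 1) := by
        nlinarith
      omega
    obtain ⟨k, hk1, hk2, hk⟩ := hlog m hij h1 hw
    have h2 := h.connected.dist_triangle (u := z) (v := w) (w := q k)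
    have h3 := hzq k (by omega)
    omega
  have hz1 := hz
  rw [mem_geodInterval] at hz1
  have hsub₀ : Γ₀.geodInterval z (q 0) ⊆ Γ₀.geodInterval (q 0) (q n) := by
    rw [geodInterval_comm z]
    exact h.connected₀.geodInterval_subset_left hz
  have hsubn : Γ₀.geodInterval z (q n) ⊆ Γ₀.geodInterval (q 0) (q n) := by
    rw [geodInterval_comm z, geodInterval_comm (q 0)]
    exact h.connected₀.geodInterval_subset_left (by rwa [geodInterval_comm])
  obtain ⟨x₁, hx₁, i, hi, hzx, hxi, hxor⟩ := side 0 (Nat.zero_le n) hsub₀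
  obtain ⟨y₁, hy₁, j, hj, hzy, hyj, hyor⟩ := side n le_rfl hsubn
  have hzxy : z ∈ Γ₀.geodInterval x₁ y₁ := by
    have h1 := h.connected₀.dist_triangle (u := x₁) (v := z) (w := y₁)
    have h2 := h.connected₀.dist_triangle (u := q 0) (v := x₁) (w := y₁)
    have h3 := h.connected₀.dist_triangle (u := q 0) (v := y₁) (w := q n)
    have e1 : Γ₀.dist x₁ (q 0) = Γ₀.dist (q 0) x₁ := dist_comm
    have e2 : Γ₀.dist z x₁ = Γ₀.dist x₁ z := dist_comm
    have e3 : Γ₀.dist z (q 0) = Γ₀.dist (q 0) z := dist_comm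
    rw [mem_geodInterval] at hx₁ hy₁ ⊢
    omega
  have hqij : Γ.dist (q i) (q j) ≤ 6 * D + 2 * K := by
    have h1 := h.connected.dist_triangle (u := q i) (v := x₁) (w := q j)
    have h2 := h.connected.dist_triangle (u := x₁) (v := z) (w := q j)
    have h3 := h.connected.dist_triangle (u := z) (v := y₁) (w := q j)
    have e1 : Γ.dist (q i) x₁ = Γ.dist x₁ (q i) := dist_comm
    have e2 : Γ.dist x₁ z = Γ.dist z x₁ := dist_comm
    omega
  obtain ⟨w, hw, hzw⟩ := hδ.quadrilateral h.connected₀ (a := q i) (b := q j) hzxy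
  have hzw' : Γ.dist z w ≤ 2 * (K * δ) := by
    calc Γ.dist z w ≤ K * Γ₀.dist z w := h.dist_le z w
      _ ≤ K * (2 * δ) := Nat.mul_le_mul_left K hzw
      _ = _ := by ring
  refine le_trans ?_ hABm
  rcases hw with hw | hw | hw
  · exact short hi hxi hxor hw hzw'
  · rcases le_total i j with hij | hij
    · exact long hi hj hqij hij hw hzw'
    · rw [geodInterval_comm] at hw
      exact long hj hi (by rwa [dist_comm]) hij hw hzw'
  · rw [geodInterval_comm] at hw
    exact short hj hyj hyor hw hzw'

theorem Comparison.exists_mem_support_dist_le_of_isGeodesicWalk {K δ : ℕ}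
    (h : Comparison Γ₀ Γ K) (hδ : Γ₀.Slim δ) :
    ∃ R, ∀ {x y z : V} (p : Γ.Walk x y), IsGeodesicWalk Γ p → z ∈ Γ₀.geodInterval x y →
      ∃ i ≤ p.length, Γ.dist z (p.getVert i) ≤ R := by
  obtain ⟨R, hR⟩ := h.morse hδ 1 1
  refine ⟨R, fun {x y z} p hp hz => ?_⟩
  refine hR p.getVert p.length p.dist_getVert_succ_le (fun i j hij hj => ?_) z (by simpa using hz)
  rw [h.connected.dist_getVert hp hij hj]
  omega

/-- `Γ₀`-geodesics are `Γ`-close to `Γ`-geodesics. -/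
theorem Comparison.exists_mem_geodInterval_dist_le {K δ : ℕ} (h : Comparison Γ₀ Γ K)
    (hδ : Γ₀.Slim δ) : ∃ R, ∀ {x y z : V}, z ∈ Γ₀.geodInterval x y →
      ∃ t ∈ Γ.geodInterval x y, Γ.dist z t ≤ R := by
  obtain ⟨R, hR⟩ := h.exists_mem_support_dist_le_of_isGeodesicWalk hδ
  refine ⟨R, fun {x y z} hz => ?_⟩
  obtain ⟨p, hp⟩ := h.connected.exists_isGeodesicWalk x y
  obtain ⟨i, -, hi⟩ := hR p hp hz
  exact ⟨_, h.connected.mem_geodInterval_of_isGeodesicWalk hp (p.getVert_mem_support i), hi⟩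

/-- `Γ`-geodesics are `Γ`-close to `Γ₀`-geodesics: the points of a `Γ`-geodesic that are close to a
`Γ₀`-geodesic leave no large gap. -/
theorem Comparison.exists_mem_geodInterval_dist_le' {K δ : ℕ} (h : Comparison Γ₀ Γ K)
    (hδ : Γ₀.Slim δ) : ∃ R, ∀ {x y z : V}, z ∈ Γ.geodInterval x y →
      ∃ t ∈ Γ₀.geodInterval x y, Γ.dist z t ≤ R := by
  obtain ⟨R, hR⟩ := h.exists_mem_support_dist_le_of_isGeodesicWalk hδ
  refine ⟨3 * R + K, fun {x y z} hz => ?_⟩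
  obtain ⟨p, hp, hzp⟩ := h.connected.exists_isGeodesicWalk_mem hz
  obtain ⟨i, rfl, hi⟩ := Walk.mem_support_iff_exists_getVert.mp hzp
  obtain ⟨p₀, hp₀⟩ := h.connected₀.exists_isGeodesicWalk x y
  have hmem : ∀ k, p₀.getVert k ∈ Γ₀.geodInterval x y := fun k =>
    h.connected₀.mem_geodInterval_of_isGeodesicWalk hp₀ (p₀.getVert_mem_support k)
  have hex : ∃ k, ∃ j ≤ p.length, i ≤ j ∧ Γ.dist (p₀.getVert k) (p.getVert j) ≤ R :=
    ⟨p₀.length, p.length, le_rfl, hi, by simp⟩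
  classical
  obtain ⟨j, hj, hij, hd⟩ := Nat.find_spec hex
  have hmin := fun m => Nat.find_min hex (m := m)
  set k := Nat.find hex
  refine ⟨p₀.getVert k, hmem k, ?_⟩
  have hij' := h.connected.dist_getVert hp hij hj
  rcases Nat.eq_zero_or_pos k with h0 | h0
  · rw [h0, Walk.getVert_zero] at hd ⊢
    have h1 := h.connected.dist_getVert hp (Nat.zero_le i) hi
    have h2 := h.connected.dist_getVert hp (Nat.zero_le j) hj
    rw [Walk.getVert_zero] at h1 h2
    rw [dist_comm]
    omega
  · obtain ⟨j', hj', hd'⟩ := hR p hp (hmem (k - 1))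
    have hlt : j' < i := by
      by_contra! hle
      exact hmin (k - 1) (by omega) ⟨j', hj', hle, hd'⟩
    have h1 := h.connected.dist_getVert hp (hlt.le.trans hij) hj
    have h4 := p₀.dist_getVert_succ_le (k - 1)
    rw [Nat.sub_add_cancel h0] at h4
    have h5 := h.dist_le (p₀.getVert (k - 1)) (p₀.getVert k)
    have h7 : K * Γ₀.dist (p₀.getVert (k - 1)) (p₀.getVert k) ≤ K * 1 := Nat.mul_le_mul_left K h4
    have h8 := h.connected.dist_triangle (u := p.getVert j') (v := p₀.getVert (k - 1))
      (w := p.getVert j)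
    have h9 := h.connected.dist_triangle (u := p₀.getVert (k - 1)) (v := p₀.getVert k)
      (w := p.getVert j)
    have h10 := h.connected.dist_triangle (u := p.getVert i) (v := p.getVert j)
      (w := p₀.getVert k)
    have e1 : Γ.dist (p.getVert j') (p₀.getVert (k - 1)) =
      Γ.dist (p₀.getVert (k - 1)) (p.getVert j') := dist_comm
    have e2 : Γ.dist (p.getVert j) (p₀.getVert k) = Γ.dist (p₀.getVert k) (p.getVert j) :=
      dist_comm
    omega

/-- Hyperbolicity passes from `Γ₀` to `Γ`. -/
theorem Comparison.exists_slim {K δ : ℕ} (h : Comparison Γ₀ Γ K) (hδ : Γ₀.Slim δ) :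
    ∃ δ', Γ.Slim δ' := by
  obtain ⟨R, hR⟩ := h.exists_mem_geodInterval_dist_le hδ
  obtain ⟨R', hR'⟩ := h.exists_mem_geodInterval_dist_le' hδ
  refine ⟨R' + K * δ + R, fun x y z v hv => ?_⟩
  obtain ⟨v₀, hv₀, hd⟩ := hR' hv
  obtain ⟨w₀, hw₀, hd₀⟩ := hδ x y z v₀ hv₀
  have h1 := h.dist_le v₀ w₀
  have h2 : K * Γ₀.dist v₀ w₀ ≤ K * δ := Nat.mul_le_mul_left K hd₀
  have h3 := h.connected.dist_triangle (u := v) (v := v₀) (w := w₀)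
  rcases hw₀ with hw₀ | hw₀
  all_goals
    obtain ⟨w, hw, hd'⟩ := hR hw₀
    have h4 := h.connected.dist_triangle (u := v) (v := w₀) (w := w)
    exact ⟨w, by tauto, by omega⟩

end SimpleGraph

namespace SimpleGraph

variable {G : Type*} [Group G] {Γ : SimpleGraph G}

/-! ### Left-invariant slim graphs on a group and their loxodromic elements -/

/-- The length of a group element with respect to a graph on the group. -/
noncomputable def len (Γ : SimpleGraph G) (x : G) : ℕ := Γ.dist 1 x

theorem len_one : Γ.len (1 : G) = 0 := by simp [len]

/-- `Γ` is a connected graph on the group `G` that is invariant under left translations and has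
`δ`-slim triangles. -/
structure InvariantSlim (Γ : SimpleGraph G) (δ : ℕ) : Prop where
  connected : Γ.Connected
  adj_mul_left : ∀ g x y : G, Γ.Adj x y → Γ.Adj (g * x) (g * y)
  slim : Γ.Slim δ

theorem dist_mul_left (hΓ : Γ.Connected) (hinv : ∀ g x y : G, Γ.Adj x y → Γ.Adj (g * x) (g * y))
    (g x y : G) : Γ.dist (g * x) (g * y) = Γ.dist x y := by
  have key : ∀ g x y : G, Γ.dist (g * x) (g * y) ≤ Γ.dist x y := fun g x y => by
    obtain ⟨p, hp⟩ := hΓ.exists_walk_length_eq_dist x y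
    let f : Γ →g Γ := ⟨fun x => g * x, fun h => hinv g _ _ h⟩
    exact (Γ.dist_le (p.map f)).trans (by rw [Walk.length_map, hp])
  exact le_antisymm (key g x y) (by simpa using key g⁻¹ (g * x) (g * y))

namespace InvariantSlim

variable {δ : ℕ} (h : Γ.InvariantSlim δ)
include h

theorem dist_eq_len {x y g : G} (hg : x⁻¹ * y = g) : Γ.dist x y = Γ.len g := by
  rw [← hg, len, ← dist_mul_left h.connected h.adj_mul_left x⁻¹ x y, inv_mul_cancel]

theorem len_inv (x : G) : Γ.len x⁻¹ = Γ.len x := by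
  rw [← h.dist_eq_len (x := x) (y := 1) (by rw [mul_one]), len, dist_comm]

theorem len_mul_le (x y : G) : Γ.len (x * y) ≤ Γ.len x + Γ.len y := by
  rw [← h.dist_eq_len (x := x) (y := x * y) (g := y) (by group)]
  exact h.connected.dist_triangle

theorem fourPoint_one (x y z : G) : Γ.dist x z + Γ.len y ≤
    max (Γ.dist x y + Γ.len z) (Γ.dist y z + Γ.len x) + (6 * δ + 4) := by
  have := h.slim.fourPoint h.connected x y z 1
  rw [Γ.dist_comm (u := y) (v := 1), Γ.dist_comm (u := x) (v := 1),
    Γ.dist_comm (u := z) (v := 1)] at this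
  exact this

end InvariantSlim

/-- An element whose square is substantially longer than itself, compared to the constant
`6 * δ + 4` of the four-point condition.  Then its powers lie along a quasi-geodesic. -/
def IsStraight (Γ : SimpleGraph G) (δ : ℕ) (w : G) : Prop :=
  Γ.len w + 2 * (6 * δ + 4) + 1 ≤ Γ.len (w ^ 2)

namespace InvariantSlim

variable {δ : ℕ} (h : Γ.InvariantSlim δ) {w : G}
include h

theorem isStraight_inv (hw : Γ.IsStraight δ w) : Γ.IsStraight δ w⁻¹ := by
  rwa [IsStraight, inv_pow, h.len_inv, h.len_inv]

theorem len_pow_succ_ge (hw : Γ.IsStraight δ w) (n : ℕ) :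
    Γ.len (w ^ n) + (6 * δ + 4) + 1 ≤ Γ.len (w ^ (n + 1)) := by
  rw [IsStraight] at hw
  induction n with
  | zero =>
    have := h.len_mul_le w w
    rw [← pow_two] at this
    rw [pow_zero, zero_add, pow_one, len_one]
    omega
  | succ n ih =>
    -- The four points `1`, `w ^ n`, `w ^ (n + 1)`, `w ^ (n + 2)`.
    have h1 := h.fourPoint_one (w ^ n) (w ^ (n + 1)) (w ^ (n + 2))
    rw [h.dist_eq_len (g := w ^ 2) (by group), h.dist_eq_len (g := w) (by group),
      h.dist_eq_len (g := w) (by group)] at h1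
    rw [show n + 1 + 1 = n + 2 from rfl]
    omega

theorem le_len_pow (hw : Γ.IsStraight δ w) (n : ℕ) : n ≤ Γ.len (w ^ n) := by
  induction n with
  | zero => simp
  | succ n ih =>
    have := h.len_pow_succ_ge hw n
    omega

/-- Positive and negative powers of a straight element have bounded Gromov products. -/
theorem len_pow_add_len_pow_le (hw : Γ.IsStraight δ w) (k l : ℕ) :
    Γ.len (w ^ k) + Γ.len (w ^ l) ≤ Γ.len (w ^ (k + l)) + Γ.len w := by
  rcases Nat.eq_zero_or_pos k with rfl | hk
  · simp [len_one]
  obtain ⟨k, rfl⟩ : ∃ m, k = m + 1 := ⟨k - 1, by omega⟩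
  have h1 := h.fourPoint_one w (w ^ (k + 1)) (w ^ l)⁻¹
  rw [h.len_inv, Γ.dist_comm (u := w) (v := w ^ (k + 1)),
    Γ.dist_comm (u := w) (v := (w ^ l)⁻¹),
    h.dist_eq_len (x := (w ^ l)⁻¹) (g := w ^ (l + 1)) (by group),
    h.dist_eq_len (x := w ^ (k + 1)) (g := (w ^ k)⁻¹) (by group),
    h.dist_eq_len (x := w ^ (k + 1)) (g := (w ^ (k + 1 + l))⁻¹) (by group), h.len_inv,
    h.len_inv] at h1
  have h2 := h.len_pow_succ_ge hw k
  have h3 := h.len_pow_succ_ge hw l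
  omega

theorem exists_len_eq (hunb : ∀ n, ∃ g : G, n ≤ Γ.len g) (n : ℕ) :
    ∃ g : G, Γ.len g = n := by
  obtain ⟨g, hg⟩ := hunb n
  obtain ⟨v, -, hv⟩ := h.connected.exists_mem_geodInterval_dist_eq hg
  exact ⟨v, hv⟩

/-- If the graph is unbounded, then there is a straight element.  Center a long geodesic at `1`, and
let `a` and `b` be its ends.  If neither `a` nor `b` is straight, then `a⁻¹ * b` and its inverse
start in the different directions of `a` and of `b`. -/
theorem exists_isStraight (hunb : ∀ n, ∃ g : G, n ≤ Γ.len g) : ∃ w : G, Γ.IsStraight δ w := by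
  obtain ⟨g, hg⟩ := h.exists_len_eq hunb (2 * (20 * (6 * δ + 4) + 20))
  set L := 20 * (6 * δ + 4) + 20 with hL
  obtain ⟨m, hm, hml⟩ := h.connected.exists_mem_geodInterval_dist_eq (x := 1) (y := g) (k := L)
    (by rw [len] at hg; omega)
  by_contra! hno
  set a := m⁻¹ with ha
  set b := m⁻¹ * g with hb
  have hla : Γ.len a = L := by rw [ha, h.len_inv]; exact hml
  have hlb : Γ.len b = L := by
    rw [← h.dist_eq_len (x := m) (y := g) hb.symm]
    rw [mem_geodInterval] at hm
    rw [len] at hg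
    omega
  have hlw : Γ.len (a⁻¹ * b) = 2 * L := by rw [ha, hb]; simpa using hg
  have e : Γ.dist a b = 2 * L := by rw [h.dist_eq_len rfl]; exact hlw
  have h1 := hno a
  have h2 := hno b
  have h3 := hno (a⁻¹ * b)
  rw [IsStraight, not_le] at h1 h2 h3
  set w := a⁻¹ * b with hw
  have d1 : Γ.dist a a⁻¹ = Γ.len (a ^ 2) := by
    rw [h.dist_eq_len (g := (a ^ 2)⁻¹) (by group), h.len_inv]
  have d2 : Γ.dist b b⁻¹ = Γ.len (b ^ 2) := by
    rw [h.dist_eq_len (g := (b ^ 2)⁻¹) (by group), h.len_inv]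
  have d3 : Γ.dist a⁻¹ w = L := by rw [h.dist_eq_len (g := b) (by rw [hw]; group), hlb]
  have d4 : Γ.dist b⁻¹ w⁻¹ = L := by rw [h.dist_eq_len (g := a) (by rw [hw]; group), hla]
  have d5 : Γ.dist w w⁻¹ = Γ.len (w ^ 2) := by
    rw [h.dist_eq_len (g := (w ^ 2)⁻¹) (by group), h.len_inv]
  have f1 := h.fourPoint_one a a⁻¹ w
  have f2 := h.fourPoint_one b b⁻¹ w⁻¹
  have f3 := h.fourPoint_one a w b
  have f4 := h.fourPoint_one w w⁻¹ b
  rw [h.len_inv] at f1 f2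
  rw [h.len_inv] at f2 f4
  have e1 : Γ.dist w⁻¹ b = Γ.dist b w⁻¹ := dist_comm
  omega

end InvariantSlim

end SimpleGraph

/-! ### Sets covered by finitely many cosets of infinite-index subgroups -/

/-- `E` is contained in a finite union of left cosets of subgroups of infinite index. -/
def IsCosetSmall {G : Type*} [Group G] (E : Set G) : Prop :=
  ∃ F : Set (G × Subgroup G), F.Finite ∧ (∀ p ∈ F, p.2.index = 0) ∧
    ∀ x ∈ E, ∃ p ∈ F, p.1⁻¹ * x ∈ p.2

namespace IsCosetSmall

variable {G : Type*} [Group G] {E E' : Set G}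

/-- B. H. Neumann's lemma. -/
theorem exists_notMem (h : IsCosetSmall E) : ∃ x, x ∉ E := by
  obtain ⟨F, hF, hind, hcov⟩ := h
  by_contra! hall
  obtain ⟨p, hp, hfin⟩ := Subgroup.exists_finiteIndex_of_leftCoset_cover (s := hF.toFinset)
    (g := Prod.fst) (H := Prod.snd) (by
      refine Set.eq_univ_of_forall fun x => ?_
      obtain ⟨p, hp, hx⟩ := hcov x (hall x)
      simp only [Set.mem_iUnion, Set.Finite.mem_toFinset]
      exact ⟨p, hp, mem_leftCoset_iff _ |>.mpr hx⟩)
  exact hfin.index_ne_zero (hind p (hF.mem_toFinset.mp hp))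

theorem mono (h : IsCosetSmall E) (hE : E' ⊆ E) : IsCosetSmall E' := by
  obtain ⟨F, hF, hind, hcov⟩ := h
  exact ⟨F, hF, hind, fun x hx => hcov x (hE hx)⟩

theorem union (h : IsCosetSmall E) (h' : IsCosetSmall E') : IsCosetSmall (E ∪ E') := by
  obtain ⟨F, hF, hind, hcov⟩ := h
  obtain ⟨F', hF', hind', hcov'⟩ := h'
  refine ⟨F ∪ F', hF.union hF', fun p hp => hp.elim (hind p) (hind' p), ?_⟩
  rintro x (hx | hx)
  · obtain ⟨p, hp, hpx⟩ := hcov x hx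
    exact ⟨p, Or.inl hp, hpx⟩
  · obtain ⟨p, hp, hpx⟩ := hcov' x hx
    exact ⟨p, Or.inr hp, hpx⟩

theorem mul_left (h : IsCosetSmall E) (g : G) : IsCosetSmall {x | g * x ∈ E} := by
  obtain ⟨F, hF, hind, hcov⟩ := h
  refine ⟨(fun p => (g⁻¹ * p.1, p.2)) '' F, hF.image _, ?_, fun x hx => ?_⟩
  · rintro _ ⟨p, hp, rfl⟩
    exact hind p hp
  · obtain ⟨p, hp, hpx⟩ := hcov _ hx
    exact ⟨_, ⟨p, hp, rfl⟩, by simpa [mul_assoc] using hpx⟩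

theorem inv (h : IsCosetSmall E) : IsCosetSmall {x | x⁻¹ ∈ E} := by
  obtain ⟨F, hF, hind, hcov⟩ := h
  refine ⟨(fun p => (p.1⁻¹, p.2.comap (MulAut.conj p.1⁻¹).toMonoidHom)) '' F, hF.image _, ?_,
    fun x hx => ?_⟩
  · rintro _ ⟨p, hp, rfl⟩
    rw [Subgroup.index_comap_of_surjective _ (MulAut.conj p.1⁻¹).surjective]
    exact hind p hp
  · obtain ⟨p, hp, hpx⟩ := hcov _ hx
    refine ⟨_, ⟨p, hp, rfl⟩, ?_⟩
    simpa [Subgroup.mem_comap, mul_assoc] using p.2.inv_mem hpx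

theorem of_finite [Infinite G] (hE : E.Finite) : IsCosetSmall E := by
  refine ⟨(fun x => (x, ⊥)) '' E, hE.image _, ?_, fun x hx => ⟨_, ⟨x, hx, rfl⟩, by simp⟩⟩
  rintro _ ⟨x, -, rfl⟩
  rw [Subgroup.index_bot]
  exact Nat.card_eq_zero_of_infinite

theorem of_mul_mul {A B : Set G} {𝓗 : Set (Subgroup G)} (hA : A.Finite) (hB : B.Finite)
    (h𝓗 : 𝓗.Finite) (hind : ∀ H ∈ 𝓗, H.index = 0) :
    IsCosetSmall {x | ∃ a ∈ A, ∃ H ∈ 𝓗, ∃ h ∈ H, ∃ b ∈ B, x = a * h * b} := by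
  refine ⟨(fun p : (G × G) × Subgroup G =>
    (p.1.1 * p.1.2, p.2.comap (MulAut.conj p.1.2).toMonoidHom)) '' ((A ×ˢ B) ×ˢ 𝓗),
    ((hA.prod hB).prod h𝓗).image _, ?_, ?_⟩
  · rintro _ ⟨p, ⟨-, hp⟩, rfl⟩
    rw [Subgroup.index_comap_of_surjective _ (MulAut.conj p.1.2).surjective]
    exact hind _ hp
  · rintro x ⟨a, ha, H, hH, h, hh, b, hb, rfl⟩
    refine ⟨_, ⟨((a, b), H), ⟨⟨ha, hb⟩, hH⟩, rfl⟩, ?_⟩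
    simpa [Subgroup.mem_comap, mul_assoc] using hh

end IsCosetSmall

/-! ### Unboundedness of coned-off graphs -/

/-- If the conjugates of `s` by the powers of `w` form a finite set, then some power of `w` commutes
with `s`. -/
theorem exists_pow_commute_of_finite_conj {G : Type*} [Group G] {w s : G} {A : Set G}
    (hA : A.Finite) (hs : ∀ j : ℕ, w ^ j * s * (w ^ j)⁻¹ ∈ A) :
    ∃ m : ℕ, 0 < m ∧ Commute (w ^ m) s := by
  have : Finite A := hA
  obtain ⟨i, j, hij, heq⟩ := Finite.exists_ne_map_eq_of_infinite
    (fun j : ℕ => (⟨_, hs j⟩ : A))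
  have heq : w ^ i * s * (w ^ i)⁻¹ = w ^ j * s * (w ^ j)⁻¹ := congrArg Subtype.val heq
  have key : ∀ i j : ℕ, i < j → w ^ i * s * (w ^ i)⁻¹ = w ^ j * s * (w ^ j)⁻¹ →
      Commute (w ^ (j - i)) s := by
    intro i j hlt he
    obtain ⟨k, rfl⟩ := Nat.exists_eq_add_of_le hlt.le
    rw [Nat.add_sub_cancel_left]
    rw [pow_add, mul_inv_rev] at he
    have h1 : w ^ i * s * (w ^ i)⁻¹ = w ^ i * (w ^ k * s * (w ^ k)⁻¹) * (w ^ i)⁻¹ := by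
      rw [he]; group
    have h2 := mul_left_cancel (mul_right_cancel h1)
    rw [eq_mul_inv_iff_mul_eq] at h2
    exact h2.symm
  rcases lt_or_gt_of_ne hij with hlt | hlt
  · exact ⟨j - i, by omega, key i j hlt heq⟩
  · exact ⟨i - j, by omega, key j i hlt heq.symm⟩

namespace SimpleGraph.InvariantSlim

variable {G : Type*} [Group G] {Γ : SimpleGraph G} {δ : ℕ} (h : Γ.InvariantSlim δ) {w : G}
include h

/-- The set of elements that start in the direction of the positive powers of `w` is not small.
Otherwise a generic `y` starts in the direction of `w ^ (-j)`, and so does every translate `s * y`.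
So left translation by `s` moves `w ^ (-j)` a bounded amount, for all `j`, which implies that a
power of `w` is central.  But then it also follows from `y⁻¹` being generic that `y` starts in the
direction of `w ^ j`. -/
theorem not_isCosetSmall_direction (hfin : ∀ n, {x | Γ.len x ≤ n}.Finite) {S : Set G}
    (hS : S.Finite) (hgen : Subgroup.closure S = ⊤) (hw : Γ.IsStraight δ w) (c : ℕ) :
    ¬ IsCosetSmall {y | ∃ k : ℕ, c + Γ.dist y (w ^ k) < Γ.len y + Γ.len (w ^ k)} := by
  intro hsmall
  have hstart : ∀ (j : ℕ) (y : G),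
      y ∉ {x | w ^ j * x ∈ {y | ∃ k : ℕ, c + Γ.dist y (w ^ k) < Γ.len y + Γ.len (w ^ k)}} →
        Γ.len (w ^ j * y) + Γ.len (w ^ j) ≤ Γ.len y + c := by
    intro j y hy
    have h1 := not_lt.mp (not_exists.mp hy j)
    rw [Γ.dist_comm, h.dist_eq_len (g := y) (by group)] at h1
    omega
  -- A power of `w` commutes with any given element.
  have hcomm : ∀ s : G, ∃ m : ℕ, 0 < m ∧ Commute (w ^ m) s := by
    intro s
    refine exists_pow_commute_of_finite_conj (hfin (c + Γ.len s + (6 * δ + 4))) fun j => ?_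
    obtain ⟨y, hy⟩ := ((hsmall.mul_left (w ^ j)).union
      ((hsmall.mul_left (w ^ j)).mul_left s⁻¹)).exists_notMem
    rw [Set.mem_union, not_or] at hy
    have h1 := hstart j y hy.1
    have h2 := hstart j (s⁻¹ * y) hy.2
    have h3 := h.fourPoint_one (w ^ j)⁻¹ y (s * (w ^ j)⁻¹)
    have h4 := h.len_mul_le s⁻¹ y
    have h5 := h.len_mul_le s (w ^ j)⁻¹
    rw [h.dist_eq_len (g := w ^ j * s * (w ^ j)⁻¹) (by group),
      h.dist_eq_len (g := w ^ j * y) (by group), Γ.dist_comm,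
      h.dist_eq_len (g := w ^ j * (s⁻¹ * y)) (by group)] at h3
    rw [h.len_inv] at h3 h4 h5
    rw [Set.mem_ofPred_eq]
    omega
  choose m hm0 hm using hcomm
  set M := ∏ s ∈ hS.toFinset, m s with hM
  have hMpos : 0 < M := Finset.prod_pos fun s _ => hm0 s
  have hcent : ∀ y : G, Commute (w ^ M) y := by
    have hle : Subgroup.closure S ≤ Subgroup.centralizer {w ^ M} := by
      rw [Subgroup.closure_le]
      intro s hs
      obtain ⟨t, ht⟩ := Finset.dvd_prod_of_mem m (hS.mem_toFinset.mpr hs)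
      rw [SetLike.mem_coe, Subgroup.mem_centralizer_singleton_iff, hM, ht, pow_mul]
      exact (((hm s).pow_left t).eq).symm
    intro y
    have hy : y ∈ Subgroup.centralizer {w ^ M} := hle (hgen ▸ Subgroup.mem_top y)
    exact (Subgroup.mem_centralizer_singleton_iff.mp hy).symm
  set N := M * (c + (6 * δ + 4) + 1) with hN
  have hNc : ∀ y : G, Commute (w ^ N) y := fun y => by
    rw [hN, pow_mul]
    exact (hcent y).pow_left _
  obtain ⟨y, hy⟩ := ((hsmall.mul_left (w ^ N)).union
    (hsmall.mul_left (w ^ N)).inv).exists_notMem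
  rw [Set.mem_union, not_or] at hy
  have h1 := hstart N y hy.1
  have h2 := hstart N y⁻¹ hy.2
  have h3 := h.fourPoint_one (w ^ N) y (w ^ N)⁻¹
  rw [← h.len_inv (w ^ N * y⁻¹), (hNc y⁻¹).eq] at h2
  rw [Γ.dist_comm, h.dist_eq_len (g := w ^ (N + N)) (by group), Γ.dist_comm,
    h.dist_eq_len (x := y) (y := w ^ N) (g := (w ^ N)⁻¹⁻¹ * y⁻¹)
      (by rw [inv_inv]; exact ((hNc y⁻¹).eq).symm), Γ.dist_comm,
    h.dist_eq_len (g := w ^ N * y) (by group), inv_inv] at h3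
  have h4 := h.le_len_pow hw (N + N)
  have h5 : c + (6 * δ + 4) + 1 ≤ N := Nat.le_mul_of_pos_left _ hMpos
  have h6 := h.len_inv y
  rw [h.len_inv] at h2 h3
  rw [← (hNc y⁻¹).eq] at h2
  omega

/-- The shadow of any element `u` is not small, where the constant does not depend on `u`: seen
from `u`, the point `1` does not lie both in the direction of the positive powers of `w` and in the
direction of the negative powers. -/
theorem exists_not_isCosetSmall_shadow (hfin : ∀ n, {x | Γ.len x ≤ n}.Finite) {S : Set G}
    (hS : S.Finite) (hgen : Subgroup.closure S = ⊤) (hw : Γ.IsStraight δ w) :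
    ∃ r, ∀ u : G, ¬ IsCosetSmall {v | Γ.len u + Γ.dist u v ≤ Γ.len v + r} := by
  refine ⟨Γ.len w + 2 * (6 * δ + 4), fun u hsmall => ?_⟩
  have key : ∀ w' : G, Γ.IsStraight δ w' →
      (∀ k : ℕ, Γ.len u + Γ.len (w' ^ k) ≤ Γ.len w + (6 * δ + 4) + Γ.dist u⁻¹ (w' ^ k)) →
        False := by
    intro w' hw' hk
    refine h.not_isCosetSmall_direction hfin hS hgen hw' (Γ.len w + 2 * (6 * δ + 4))
      ((hsmall.mul_left u).mono ?_)
    rintro y ⟨k, hy⟩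
    have h1 := hk k
    have h2 := h.fourPoint_one u⁻¹ y (w' ^ k)
    rw [h.len_inv, h.dist_eq_len (x := u⁻¹) (y := y) (g := u * y) (by group)] at h2
    rw [Set.mem_ofPred_eq, Set.mem_ofPred_eq, h.dist_eq_len (g := y) (by group)]
    omega
  by_cases hpos : ∀ k : ℕ,
      Γ.len u + Γ.len (w ^ k) ≤ Γ.len w + (6 * δ + 4) + Γ.dist u⁻¹ (w ^ k)
  · exact key w hw hpos
  refine key w⁻¹ (h.isStraight_inv hw) fun l => ?_
  push Not at hpos
  obtain ⟨k, hk⟩ := hpos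
  have h1 := h.fourPoint_one (w ^ k) u⁻¹ (w⁻¹ ^ l)
  have h2 := h.len_pow_add_len_pow_le hw k l
  rw [h.len_inv, inv_pow, h.len_inv, Γ.dist_comm (u := w ^ k) (v := u⁻¹), Γ.dist_comm,
    h.dist_eq_len (g := w ^ (k + l)) (by group)] at h1
  rw [inv_pow, h.len_inv]
  omega

/-- If geodesics between points that are adjacent in `X` stay close to cosets of finitely many
subgroups of infinite index, then `X` is unbounded.  By induction, there is for each `n` an element
`u` whose shadow contains no point at `X`-distance at most `n` from `1`.  In the inductive step, `u`
is replaced by a point `v` of its shadow such that no coset is close to both `u` and `v`. -/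
theorem exists_dist_gt [Infinite G] (hfin : ∀ n, {x | Γ.len x ≤ n}.Finite) {S : Set G}
    (hS : S.Finite) (hgen : Subgroup.closure S = ⊤) {X : SimpleGraph G} (hX : X.Connected)
    {𝓗 : Set (Subgroup G)} (h𝓗 : 𝓗.Finite) (hind : ∀ H ∈ 𝓗, H.index = 0) {C : ℕ}
    (hclose : ∀ x y, X.Adj x y → ∃ H ∈ 𝓗, ∀ v ∈ Γ.geodInterval x y,
      ∃ a ∈ H, Γ.dist v (x * a) ≤ C) (n : ℕ) : ∃ u : G, n < X.dist 1 u := by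
  have hunb : ∀ n, ∃ g : G, n ≤ Γ.len g := by
    intro n
    obtain ⟨g, hg⟩ := (hfin n).infinite_compl.nonempty
    exact ⟨g, (lt_of_not_ge fun hle => hg hle).le⟩
  obtain ⟨w, hw⟩ := h.exists_isStraight hunb
  obtain ⟨r, hr⟩ := h.exists_not_isCosetSmall_shadow hfin hS hgen hw
  set ε := 6 * δ + 4 with hε
  suffices ∃ u : G, ∀ y, X.dist 1 y ≤ n → Γ.len y + (r + 2 * ε) < Γ.len u + Γ.dist u y by
    obtain ⟨u, hu⟩ := this
    refine ⟨u, ?_⟩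
    by_contra! hle
    have := hu u hle
    rw [dist_self] at this
    omega
  induction n with
  | zero =>
    obtain ⟨u, hu⟩ := hunb (r + 2 * ε + 1)
    refine ⟨u, fun y hy => ?_⟩
    obtain rfl := hX.dist_eq_zero_iff.mp (Nat.le_zero.mp hy)
    rw [len_one]
    omega
  | succ n ih =>
    obtain ⟨u, hu⟩ := ih
    set K := r + 3 * ε + (4 * δ + 4) + C with hK
    -- The points that are close to a coset passing near `u`, and the points that are not far away.
    have hE : IsCosetSmall ({x | ∃ a ∈ (u * ·) '' {x | Γ.len x ≤ K}, ∃ H ∈ 𝓗, ∃ h ∈ H,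
        ∃ b ∈ {x | Γ.len x ≤ K}, x = a * h * b} ∪ {x | Γ.len x ≤ Γ.len u + r + 4 * ε}) :=
      (IsCosetSmall.of_mul_mul ((hfin K).image _) (hfin K) h𝓗 hind).union
        (IsCosetSmall.of_finite (hfin _))
    obtain ⟨v, hv, hvE⟩ := Set.not_subset.mp fun hsub => hr u (hE.mono hsub)
    rw [Set.mem_union, not_or] at hvE
    obtain ⟨hvE, hvlen⟩ := hvE
    rw [Set.mem_ofPred_eq] at hv
    rw [Set.mem_ofPred_eq, not_le] at hvlen
    refine ⟨v, fun y hy => ?_⟩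
    by_contra! hyv
    -- The shadow of `v` is contained in the shadow of `u`.
    have hshadow : ∀ z, Γ.len v + Γ.dist v z ≤ Γ.len z + (r + 3 * ε) →
        Γ.len u + Γ.dist u z ≤ Γ.len z + (r + ε) := by
      intro z hz
      have h1 := h.fourPoint_one u v z
      omega
    have hyu := hshadow y (by omega)
    have hyn : ¬ X.dist 1 y ≤ n := fun hle => by
      have := hu y hle
      omega
    obtain ⟨y', hy', hd⟩ := hX.exists_mem_geodInterval_dist_eq (x := 1) (y := y) (k := n)
      (by omega)
    have hadj : X.Adj y' y := by
      rw [mem_geodInterval] at hy'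
      exact dist_eq_one_iff_adj.mp (by omega)
    have hy'u := hu y' hd.le
    have hy'v : Γ.len y' + (r + 3 * ε) < Γ.len v + Γ.dist v y' := by
      by_contra! hle
      have := hshadow y' hle
      omega
    -- A geodesic from `y'` to `y` passes near `u` and near `v`.
    obtain ⟨H, hH, hHclose⟩ := hclose y' y hadj
    have near : ∀ z, Γ.dist z y' + Γ.dist z y ≤ Γ.dist y' y + (r + 3 * ε) →
        ∃ a ∈ H, Γ.dist z (y' * a) ≤ K := by
      intro z hz
      obtain ⟨m, hm, hzm⟩ := h.slim.exists_mem_geodInterval_dist_le h.connected y' y z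
      obtain ⟨a, ha, hma⟩ := hHclose m hm
      have h1 := h.connected.dist_triangle (u := z) (v := m) (w := y' * a)
      exact ⟨a, ha, by omega⟩
    have f1 := h.fourPoint_one y' y u
    have f2 := h.fourPoint_one y' y v
    have e1 : Γ.dist y y' = Γ.dist y' y := dist_comm
    have e2 : Γ.dist y u = Γ.dist u y := dist_comm
    have e3 : Γ.dist y v = Γ.dist v y := dist_comm
    have e4 : Γ.dist y' u = Γ.dist u y' := dist_comm
    have e5 : Γ.dist y' v = Γ.dist v y' := dist_comm
    obtain ⟨a, ha, hua⟩ := near u (by omega)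
    obtain ⟨b, hb, hvb⟩ := near v (by omega)
    refine hvE ⟨_, ⟨u⁻¹ * (y' * a), ?_, rfl⟩, H, hH, a⁻¹ * b, H.mul_mem (H.inv_mem ha) hb,
      (y' * b)⁻¹ * v, ?_, by group⟩
    · rw [Set.mem_ofPred_eq, ← h.dist_eq_len rfl]
      exact hua
    · rw [Set.mem_ofPred_eq, ← h.dist_eq_len rfl, dist_comm]
      exact hvb

end SimpleGraph.InvariantSlim

namespace SimpleGraph

variable {G : Type*} [Group G]

/-! ### Cayley graphs and coned-off Cayley graphs of hyperbolic groups -/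

theorem mulCayley_reachable {S : Set G} (hS : Subgroup.closure S = ⊤) (x : G) :
    (mulCayley S).Reachable 1 x := by
  have hx : x ∈ Subgroup.closure S := hS ▸ Subgroup.mem_top x
  have step : ∀ x y : G, x⁻¹ * y ∈ S ∨ y⁻¹ * x ∈ S → (mulCayley S).Reachable x y := by
    intro x y hxy
    by_cases hne : x = y
    · rw [hne]
    · exact ((mulCayley_adj S x y).mpr ⟨hne, hxy⟩).reachable
  induction hx using Subgroup.closure_induction_right with
  | one => exact Reachable.refl 1
  | mul_right x _ s hs ih => exact ih.trans (step _ _ (Or.inl (by simpa using hs)))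
  | mul_inv_cancel x _ s hs ih => exact ih.trans (step _ _ (Or.inr (by simpa using hs)))

theorem mulCayley_connected {S : Set G} (hS : Subgroup.closure S = ⊤) :
    (mulCayley S).Connected :=
  ⟨fun x y => (mulCayley_reachable hS x).symm.trans (mulCayley_reachable hS y)⟩

theorem mulCayley_dist_le_one {S : Set G} {x y : G} (h : x⁻¹ * y ∈ S ∨ y⁻¹ * x ∈ S) :
    (mulCayley S).dist x y ≤ 1 := by
  by_cases hne : x = y
  · simp [hne]
  · exact (dist_eq_one_iff_adj.mpr ((mulCayley_adj S x y).mpr ⟨hne, h⟩)).le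

theorem mulCayley_adj_mul_left {S : Set G} (g x y : G) (h : (mulCayley S).Adj x y) :
    (mulCayley S).Adj (g * x) (g * y) :=
  mulCayley_adj_mul_iff_right.mpr h

theorem mulCayley_finite_setOf_len_le {S : Set G} (hfin : S.Finite)
    (hS : Subgroup.closure S = ⊤) (n : ℕ) : {x | (mulCayley S).len x ≤ n}.Finite := by
  induction n with
  | zero =>
    refine (Set.finite_singleton (1 : G)).subset fun x hx => ?_
    exact ((mulCayley_connected hS).dist_eq_zero_iff.mp (Nat.le_zero.mp hx)).symm
  | succ n ih =>
    refine (ih.union (Set.Finite.image2 (fun x s => x * s) ih (hfin.union hfin.inv))).subset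
      fun x hx => ?_
    by_cases hle : (mulCayley S).len x ≤ n
    · exact Or.inl hle
    have hxn : (mulCayley S).dist 1 x = n + 1 := le_antisymm hx (by rw [len] at hle; omega)
    obtain ⟨y, hy, hyn⟩ := (mulCayley_connected hS).exists_mem_geodInterval_dist_eq
      (x := 1) (y := x) (k := n) (by omega)
    rw [mem_geodInterval] at hy
    have hadj := ((mulCayley_adj S y x).mp (dist_eq_one_iff_adj.mp (by omega))).2
    refine Or.inr ⟨y, hyn.le, y⁻¹ * x, ?_, mul_inv_cancel_left y x⟩
    rcases hadj with h | h
    · exact Or.inl h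
    · exact Or.inr (by rw [Set.mem_inv]; simpa using h)

theorem mulCayley_exists_dist_le {S : Set G} (hfin : S.Finite) {Γ : SimpleGraph G}
    (hΓ : Γ.Connected) (hinv : ∀ g x y : G, Γ.Adj x y → Γ.Adj (g * x) (g * y)) :
    ∃ K, ∀ {x y : G}, (x⁻¹ * y ∈ S ∨ y⁻¹ * x ∈ S) → Γ.dist x y ≤ K := by
  obtain ⟨K, hK⟩ := (hfin.image Γ.len).bddAbove
  refine ⟨K, fun {x y} hxy => ?_⟩
  have key : ∀ x y : G, x⁻¹ * y ∈ S → Γ.dist x y ≤ K := fun x y hxy => by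
    rw [← dist_mul_left hΓ hinv x⁻¹, inv_mul_cancel]
    exact hK ⟨_, hxy, rfl⟩
  rcases hxy with h | h
  · exact key x y h
  · rw [dist_comm]
    exact key y x h

theorem mulCayley_comparison {S T : Set G} (hfin : S.Finite) (hS : Subgroup.closure S = ⊤)
    (hTfin : T.Finite) (hT : Subgroup.closure T = ⊤) :
    ∃ K, Comparison (mulCayley S) (mulCayley T) K := by
  have hSc := mulCayley_connected hS
  have hTc := mulCayley_connected hT
  obtain ⟨K, hK⟩ := mulCayley_exists_dist_le hfin hTc mulCayley_adj_mul_left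
  obtain ⟨K', hK'⟩ := mulCayley_exists_dist_le hTfin hSc mulCayley_adj_mul_left
  have hadj : ∀ {x y : G}, (mulCayley S).Adj x y → (mulCayley T).dist x y ≤ K :=
    fun {x y} h => hK ((mulCayley_adj S x y).mp h).2
  refine ⟨max K (K * K'), hSc, hTc, fun h => (hadj h).trans (le_max_left _ _),
    fun {x y v} hxy hv => ?_⟩
  refine (hTc.dist_le_mul_dist hSc hadj x v).trans (le_trans ?_ (le_max_right _ _))
  refine Nat.mul_le_mul_left K ?_
  have h1 := hK' ((mulCayley_adj T x y).mp hxy).2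
  rw [mem_geodInterval] at hv
  omega

theorem Connected.comparison_self {V : Type*} {Γ : SimpleGraph V} (hΓ : Γ.Connected) :
    Comparison Γ Γ 1 := by
  refine ⟨hΓ, hΓ, fun h => (dist_eq_one_iff_adj.mpr h).le, fun {x y v} h hv => ?_⟩
  have h1 := dist_eq_one_iff_adj.mpr h
  rw [mem_geodInterval] at hv
  omega

/-- All Cayley graphs of a hyperbolic group with respect to finite generating sets have slim
triangles. -/
theorem mulCayley_invariantSlim (hG : IsHyperbolicGroup G) {T : Set G} (hTfin : T.Finite)
    (hT : Subgroup.closure T = ⊤) : ∃ δ, (mulCayley T).InvariantSlim δ := by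
  obtain ⟨S, hfin, hS, hyp⟩ := hG
  obtain ⟨δ, hδ⟩ := exists_slim_of_isHyperbolicGraph hyp
  obtain ⟨K, hK⟩ := mulCayley_comparison hfin hS hTfin hT
  obtain ⟨δ', hδ'⟩ := hK.exists_slim hδ
  exact ⟨δ', mulCayley_connected hT, mulCayley_adj_mul_left, hδ'⟩

theorem InvariantSlim.exists_mem_dist_le_of_isQuasiConvexWith {Γ : SimpleGraph G} {δ : ℕ}
    (h : Γ.InvariantSlim δ) {C : ℝ} {H : Subgroup G} (hH : IsQuasiConvexWith Γ C (H : Set G))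
    {x y v : G} (hxy : x⁻¹ * y ∈ H) (hv : v ∈ Γ.geodInterval x y) :
    ∃ a ∈ H, Γ.dist v (x * a) ≤ ⌈C⌉₊ := by
  have hdist := dist_mul_left h.connected h.adj_mul_left x⁻¹
  have hv' : x⁻¹ * v ∈ Γ.geodInterval 1 (x⁻¹ * y) := by
    rw [mem_geodInterval] at hv ⊢
    rw [← inv_mul_cancel x, hdist, hdist, hdist, hv]
  obtain ⟨p, hp, hvp⟩ := h.connected.exists_isGeodesicWalk_mem hv'
  obtain ⟨a, ha, hd⟩ := hH 1 H.one_mem _ hxy p hp _ hvp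
  refine ⟨a, ha, ?_⟩
  rw [← hdist, inv_mul_cancel_left]
  exact_mod_cast hd.trans (Nat.le_ceil C)

/-- A quasi-convex subgroup is generated by its short elements. -/
theorem InvariantSlim.le_of_isQuasiConvexWith {Γ : SimpleGraph G} {δ : ℕ}
    (h : Γ.InvariantSlim δ) {C : ℝ} {H H' : Subgroup G}
    (hH : IsQuasiConvexWith Γ C (H : Set G))
    (hH' : ∀ a ∈ H, Γ.len a ≤ 2 * ⌈C⌉₊ + 1 → a ∈ H') : H ≤ H' := by
  intro g hg
  obtain ⟨p, hp⟩ := h.connected.exists_isGeodesicWalk 1 g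
  have hmem : ∀ k, ∃ a ∈ H, Γ.dist (p.getVert k) a ≤ ⌈C⌉₊ := fun k => by
    obtain ⟨a, ha, hd⟩ := h.exists_mem_dist_le_of_isQuasiConvexWith hH (x := 1) (y := g)
      (by simpa using hg) (h.connected.mem_geodInterval_of_isGeodesicWalk hp
        (p.getVert_mem_support k))
    exact ⟨a, ha, by simpa using hd⟩
  have key : ∀ k, ∃ a ∈ H, a ∈ H' ∧ Γ.dist (p.getVert k) a ≤ ⌈C⌉₊ := by
    intro k
    induction k with
    | zero => exact ⟨1, H.one_mem, H'.one_mem, by simp⟩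
    | succ k ih =>
      obtain ⟨a, ha, ha', hd⟩ := ih
      obtain ⟨b, hb, hd'⟩ := hmem (k + 1)
      refine ⟨b, hb, ?_, hd'⟩
      have hab := hH' (a⁻¹ * b) (H.mul_mem (H.inv_mem ha) hb) (by
        rw [← h.dist_eq_len rfl]
        have h1 := h.connected.dist_triangle (u := a) (v := p.getVert k) (w := b)
        have h2 := h.connected.dist_triangle (u := p.getVert k) (v := p.getVert (k + 1)) (w := b)
        have h3 := p.dist_getVert_succ_le k
        rw [Γ.dist_comm (u := a) (v := p.getVert k)] at h1
        omega)
      simpa using H'.mul_mem ha' hab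
  obtain ⟨a, ha, ha', hd⟩ := key p.length
  rw [Walk.getVert_length] at hd
  have hag := hH' (a⁻¹ * g) (H.mul_mem (H.inv_mem ha) hg) (by
    rw [← h.dist_eq_len rfl, dist_comm]
    omega)
  simpa using H'.mul_mem ha' hag

theorem InvariantSlim.finite_of_isQuasiConvexWith {Γ : SimpleGraph G} {δ : ℕ}
    (h : Γ.InvariantSlim δ) (hfin : ∀ n, {x | Γ.len x ≤ n}.Finite) {C : ℝ}
    {𝓗 : Set (Subgroup G)} (h𝓗 : ∀ H ∈ 𝓗, IsQuasiConvexWith Γ C (H : Set G)) : 𝓗.Finite := by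
  let B : Set G := {x | Γ.len x ≤ 2 * ⌈C⌉₊ + 1}
  refine Set.Finite.of_finite_image (f := fun H : Subgroup G => (H : Set G) ∩ B)
    ((hfin (2 * ⌈C⌉₊ + 1)).finite_subsets.subset (s := _) ?_) ?_
  · rintro _ ⟨H, -, rfl⟩
    exact Set.inter_subset_right
  · intro H hH H' hH' heq
    refine le_antisymm (h.le_of_isQuasiConvexWith (h𝓗 H hH) fun a ha hlen => ?_)
      (h.le_of_isQuasiConvexWith (h𝓗 H' hH') fun a ha hlen => ?_)
    · exact (heq.subset ⟨ha, hlen⟩ : a ∈ (H' : Set G) ∩ B).1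
    · exact (heq.superset ⟨ha, hlen⟩ : a ∈ (H : Set G) ∩ B).1

section ConedOff

variable {S : Set G} {𝓗 : Set (Subgroup G)}

theorem conedOffCayley_connected (hS : Subgroup.closure S = ⊤) :
    (conedOffCayley S 𝓗).Connected :=
  (mulCayley_connected hS).mono (mulCayley_mono Set.subset_union_left)

theorem conedOffCayley_adj_mul_left (g x y : G) (h : (conedOffCayley S 𝓗).Adj x y) :
    (conedOffCayley S 𝓗).Adj (g * x) (g * y) :=
  mulCayley_adj_mul_left g x y h

theorem conedOffCayley_dist_le (hS : Subgroup.closure S = ⊤) (x y : G) :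
    (conedOffCayley S 𝓗).dist x y ≤ (mulCayley S).dist x y :=
  ((mulCayley_connected hS).preconnected x y).dist_anti (mulCayley_mono Set.subset_union_left)

/-- A Cayley geodesic between adjacent points of the coned-off Cayley graph is close to a coset of a
subgroup in the family or of the trivial subgroup. -/
theorem exists_mem_dist_le_of_conedOffCayley_adj {δ : ℕ} (h : (mulCayley S).InvariantSlim δ)
    {C : ℝ} (h𝓗 : ∀ H ∈ 𝓗, IsQuasiConvexWith (mulCayley S) C (H : Set G)) (x y : G)
    (hxy : (conedOffCayley S 𝓗).Adj x y) :
    ∃ H ∈ insert ⊥ 𝓗, ∀ v ∈ (mulCayley S).geodInterval x y,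
      ∃ a ∈ H, (mulCayley S).dist v (x * a) ≤ ⌈C⌉₊ + 1 := by
  have hor := ((mulCayley_adj _ x y).mp hxy).2
  by_cases hS : x⁻¹ * y ∈ S ∨ y⁻¹ * x ∈ S
  · refine ⟨⊥, Set.mem_insert _ _, fun v hv => ⟨1, Subgroup.one_mem _, ?_⟩⟩
    have h1 := mulCayley_dist_le_one hS
    rw [mem_geodInterval] at hv
    rw [mul_one, dist_comm]
    omega
  obtain ⟨H, hH, hmem⟩ : ∃ H ∈ 𝓗, x⁻¹ * y ∈ H := by
    rw [not_or] at hS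
    rcases hor with (hs | hs) | (hs | hs)
    · exact absurd hs hS.1
    · simpa using hs
    · exact absurd hs hS.2
    · obtain ⟨H, hH, hm⟩ : ∃ H ∈ 𝓗, y⁻¹ * x ∈ H := by simpa using hs
      exact ⟨H, hH, by simpa using H.inv_mem hm⟩
  refine ⟨H, Set.mem_insert_of_mem _ hH, fun v hv => ?_⟩
  obtain ⟨a, ha, hd⟩ := h.exists_mem_dist_le_of_isQuasiConvexWith (h𝓗 H hH) hmem hv
  exact ⟨a, ha, by omega⟩

theorem conedOffCayley_comparison (hG : IsHyperbolicGroup G) (hfin : S.Finite)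
    (hS : Subgroup.closure S = ⊤) {C : ℝ}
    (h𝓗 : ∀ H ∈ 𝓗, IsQuasiConvexWith (mulCayley S) C (H : Set G)) {T : Set G}
    (hTfin : T.Finite) (hT : Subgroup.closure T = ⊤) :
    ∃ K, Comparison (mulCayley T) (conedOffCayley S 𝓗) K := by
  obtain ⟨δ, hδ⟩ := mulCayley_invariantSlim hG hTfin hT
  obtain ⟨δ', hδ'⟩ := mulCayley_invariantSlim hG hfin hS
  obtain ⟨K, hK⟩ := mulCayley_comparison hTfin hT hfin hS
  obtain ⟨R, hR⟩ := hK.exists_mem_geodInterval_dist_le hδ.slim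
  have hXc := conedOffCayley_connected (𝓗 := 𝓗) hS
  have hle := conedOffCayley_dist_le (𝓗 := 𝓗) hS
  refine ⟨max K (R + (⌈C⌉₊ + 1) + 1), hδ.connected, hXc,
    fun hxy => (hle _ _).trans ((hK.dist_le_of_adj hxy).trans (le_max_left _ _)),
    fun {x y v} hxy hv => le_trans ?_ (le_max_right _ _)⟩
  obtain ⟨v', hv', hd⟩ := hR hv
  obtain ⟨H, hH, hclose⟩ := exists_mem_dist_le_of_conedOffCayley_adj hδ' h𝓗 x y hxy
  obtain ⟨a, ha, hda⟩ := hclose v' hv'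
  have h1 : (conedOffCayley S 𝓗).dist x (x * a) ≤ 1 := by
    rcases Set.mem_insert_iff.mp hH with rfl | hH
    · rw [Subgroup.mem_bot.mp ha]; simp
    · exact mulCayley_dist_le_one (Or.inl (Or.inr (by
        simpa using ⟨H, hH, ha⟩)))
  have h2 := hXc.dist_triangle (u := x) (v := x * a) (w := v)
  have h3 := hXc.dist_triangle (u := x * a) (v := v') (w := v)
  have h4 := hle v' (x * a)
  have h5 := hle v v'
  rw [(conedOffCayley S 𝓗).dist_comm (u := x * a) (v := v'),
    (conedOffCayley S 𝓗).dist_comm (u := v') (v := v)] at h3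
  omega

end ConedOff

end SimpleGraph

namespace SimpleGraph

variable {G : Type*} [Group G]

/-! ### Super-divergence of straight elements -/

theorem isSuperlinear_two_rpow {A : ℝ} (hA : 0 < A) (c : ℝ) :
    IsSuperlinear fun t => (2 : ℝ) ^ ((t - c) / A - 1) := by
  refine ⟨fun t _ => by positivity, ?_⟩
  have hb : 0 < Real.log 2 / A := div_pos (Real.log_pos one_lt_two) hA
  have h1 := (tendsto_exp_mul_div_rpow_atTop 1 _ hb).const_mul_atTop
    (Real.exp_pos (Real.log 2 * (-c / A - 1)))
  refine h1.congr fun t => ?_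
  beta_reduce
  rw [Real.rpow_def_of_pos two_pos, Real.rpow_one, ← mul_div_assoc, ← Real.exp_add]
  congr 2
  field_simp
  ring

namespace InvariantSlim

variable {X : SimpleGraph G} {δ : ℕ} (h : X.InvariantSlim δ) {w : G}
include h

theorem natAbs_le_len_zpow (hw : X.IsStraight δ w) (n : ℤ) : n.natAbs ≤ X.len (w ^ n) := by
  have := h.le_len_pow hw n.natAbs
  rcases Int.natAbs_eq n with hn | hn
  · rwa [hn, zpow_natCast, Int.natAbs_natCast]
  · rwa [hn, zpow_neg, zpow_natCast, h.len_inv, Int.natAbs_neg, Int.natAbs_natCast]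

theorem len_zpow_le (w : G) (n : ℤ) : X.len (w ^ n) ≤ n.natAbs * X.len w := by
  have key : ∀ m : ℕ, X.len (w ^ m) ≤ m * X.len w := by
    intro m
    induction m with
    | zero => simp [len_one]
    | succ m ih =>
      rw [pow_succ, Nat.succ_mul]
      exact (h.len_mul_le _ _).trans (Nat.add_le_add_right ih _)
  rcases Int.natAbs_eq n with hn | hn
  · rw [hn, zpow_natCast, Int.natAbs_natCast]
    exact key _
  · rw [hn, zpow_neg, zpow_natCast, h.len_inv, Int.natAbs_neg, Int.natAbs_natCast]
    exact key _

theorem dist_zpow (w : G) (m n : ℤ) : X.dist (w ^ m) (w ^ n) = X.len (w ^ (n - m)) :=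
  h.dist_eq_len (by rw [← zpow_neg, ← zpow_add, neg_add_eq_sub])

theorem dist_mul_right_le (x y z : G) :
    X.dist (x * z) (y * z) ≤ X.dist x y + 2 * X.len z ∧
      X.dist x y ≤ X.dist (x * z) (y * z) + 2 * X.len z := by
  have hx : X.dist x (x * z) = X.len z := h.dist_eq_len (by group)
  have hy : X.dist y (y * z) = X.len z := h.dist_eq_len (by group)
  have h1 := h.connected.dist_triangle (u := x * z) (v := x) (w := y * z)
  have h2 := h.connected.dist_triangle (u := x) (v := y) (w := y * z)
  have h3 := h.connected.dist_triangle (u := x) (v := x * z) (w := y)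
  have h4 := h.connected.dist_triangle (u := x * z) (v := y * z) (w := y)
  rw [X.dist_comm (u := x * z) (v := x)] at h1
  rw [X.dist_comm (u := y * z) (v := y)] at h4
  omega

theorem isLoxodromic (hw : X.IsStraight δ w) : IsLoxodromic X w := by
  intro x
  have hone : (1 : ℝ) ≤ X.len w + 1 := by simp
  refine ⟨X.len w + 1, 2 * X.len x, hone, by positivity, fun m n => ?_⟩
  obtain ⟨h1, h2⟩ := h.dist_mul_right_le (w ^ m) (w ^ n) x
  rw [h.dist_zpow] at h1 h2
  have h3 := h.natAbs_le_len_zpow hw (n - m)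
  have h4 := h.len_zpow_le w (n - m)
  have habs : |(m : ℝ) - n| = ((n - m).natAbs : ℝ) := by
    rw [Nat.cast_natAbs, abs_sub_comm]
    push_cast
    rfl
  rw [smul_eq_mul, smul_eq_mul, habs]
  set N := (n - m).natAbs
  constructor
  · have h5 : (N : ℝ) ≤ X.dist (w ^ m * x) (w ^ n * x) + 2 * X.len x := by
      exact_mod_cast h3.trans h2
    have h6 : (N : ℝ) / (X.len w + 1) ≤ N := div_le_self (Nat.cast_nonneg N) hone
    linarith
  · have h5 : (X.dist (w ^ m * x) (w ^ n * x) : ℝ) ≤ N * X.len w + 2 * X.len x := by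
      exact_mod_cast h1.trans (Nat.add_le_add_right h4 _)
    have h6 : (0 : ℝ) ≤ N := Nat.cast_nonneg N
    linarith

omit h in
theorem exists_isXProjection (x₀ : G) {A : Set G} (hA : A.Nonempty) :
    ∃ π : G → G, IsXProjection X x₀ A π := by
  have key : ∀ g : G, ∃ a ∈ A, ∀ b ∈ A, X.dist (g • x₀) (a • x₀) ≤ X.dist (g • x₀) (b • x₀) := by
    intro g
    obtain ⟨a, ha, heq⟩ := Nat.sInf_mem (hA.image fun a => X.dist (g • x₀) (a • x₀))
    exact ⟨a, ha, fun b hb => heq.le.trans (Nat.sInf_le ⟨b, hb, rfl⟩)⟩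
  choose π hπ hmin using key
  exact ⟨π, fun g => ⟨hπ g, hmin g⟩⟩

theorem eq_of_isXProjection {x₀ : G} {A : Set G} {π : G → G} (hπ : IsXProjection X x₀ A π)
    {a : G} (ha : a ∈ A) : π a = a := by
  have h1 := (hπ a).2 a ha
  rw [dist_self, Nat.le_zero, h.connected.dist_eq_zero_iff] at h1
  exact (mul_right_cancel h1).symm

variable {Γ : SimpleGraph G} {δ' K : ℕ} (hΓ : Γ.InvariantSlim δ') (hK : Comparison Γ X K)
include hΓ hK

/-- If the orbit of `w` is a quasi-geodesic in `X`, then it is also one in `Γ`, so `Γ`-geodesics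
between powers of `w` stay close to the powers of `w`. -/
theorem exists_dist_zpow_le (hw : X.IsStraight δ w) : ∃ R, ∀ (i j : ℤ),
    ∀ v ∈ Γ.geodInterval (w ^ i) (w ^ j), ∃ k : ℤ, Γ.dist v (w ^ k) ≤ R := by
  obtain ⟨R, hR⟩ := hΓ.connected.comparison_self.morse hΓ.slim (Γ.len w) K
  have key : ∀ i j : ℤ, i ≤ j → ∀ v ∈ Γ.geodInterval (w ^ i) (w ^ j),
      ∃ k : ℤ, Γ.dist v (w ^ k) ≤ R := by
    intro i j hij v hv
    obtain ⟨n, rfl⟩ := Int.le.dest hij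
    have hstep : ∀ k : ℕ, Γ.dist (w ^ (i + (k : ℤ))) (w ^ (i + ((k + 1 : ℕ) : ℤ))) ≤ Γ.len w := by
      intro k
      rw [hΓ.dist_zpow, show (i + ((k + 1 : ℕ) : ℤ)) - (i + (k : ℤ)) = 1 by push_cast; ring,
        zpow_one]
    have hquasi : ∀ k l : ℕ, k ≤ l → l ≤ n →
        l ≤ k + K * (Γ.dist (w ^ (i + (k : ℤ))) (w ^ (i + (l : ℤ))) + 1) := by
      intro k l hkl _
      have h1 := h.natAbs_le_len_zpow hw ((i + (l : ℤ)) - (i + (k : ℤ)))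
      rw [← h.dist_zpow] at h1
      have h2 := hK.dist_le (w ^ (i + (k : ℤ))) (w ^ (i + (l : ℤ)))
      rw [mul_add]
      omega
    obtain ⟨k, -, hk⟩ := hR (fun k => w ^ (i + (k : ℤ))) n hstep hquasi v (by simpa using hv)
    exact ⟨_, hk⟩
  refine ⟨R, fun i j v hv => ?_⟩
  rcases le_total i j with hij | hij
  · exact key i j hij v hv
  · exact key j i hij v (by rwa [geodInterval_comm])

/-- A power of `w` that is `Γ`-close to a `Γ`-geodesic from `x` to `π x` is `Γ`-close to `π x`,
although `π x` is a closest point with respect to `X`. -/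
theorem exists_dist_projection_le (hw : X.IsStraight δ w) {x₀ : G} {π : G → G}
    (hπ : IsXProjection X x₀ (Subgroup.zpowers w : Set G) π) (D : ℕ) : ∃ ρ, ∀ (x v : G) (k : ℤ),
      v ∈ Γ.geodInterval x (π x) → Γ.dist v (w ^ k) ≤ D → Γ.dist (w ^ k) (π x) ≤ ρ := by
  obtain ⟨R, hR⟩ := hK.exists_mem_geodInterval_dist_le hΓ.slim
  refine ⟨(2 * (R + K * D) + 4 * X.len x₀) * Γ.len w, fun x v k hv hvk => ?_⟩
  obtain ⟨u, hu, hvu⟩ := hR hv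
  obtain ⟨⟨i, hi⟩, hmin⟩ := hπ x
  have hi : w ^ i = π x := hi
  have h1 := hmin (w ^ k) ⟨k, rfl⟩
  rw [smul_eq_mul, smul_eq_mul, smul_eq_mul] at h1
  have h2 := (h.dist_mul_right_le x (π x) x₀).2
  have h3 := (h.dist_mul_right_le x (w ^ k) x₀).1
  have h4 := h.connected.dist_triangle (u := x) (v := u) (w := w ^ k)
  have h5 := h.connected.dist_triangle (u := u) (v := v) (w := w ^ k)
  have h6 := (hK.dist_le v (w ^ k)).trans (Nat.mul_le_mul_left K hvk)
  have h7 := h.connected.dist_triangle (u := w ^ k) (v := u) (w := π x)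
  rw [X.dist_comm (u := u) (v := v)] at h5
  rw [X.dist_comm (u := w ^ k) (v := u), ← hi, h.dist_zpow, hi] at h7
  have h8 := h.natAbs_le_len_zpow hw (i - k)
  rw [mem_geodInterval] at hu
  rw [← hi, hΓ.dist_zpow]
  exact (hΓ.len_zpow_le w _).trans (Nat.mul_le_mul_right _ (by omega))

/-- The middle of a `Γ`-geodesic from `π x` to `π y` is close to a `Γ`-geodesic from `x` to `y`,
and hence at most logarithmically far from any path from `x` to `y`. -/
theorem isSuperDivergentProjection (hw : X.IsStraight δ w) {x₀ : G} {π : G → G}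
    (hπ : IsXProjection X x₀ (Subgroup.zpowers w : Set G) π) :
    IsSuperDivergentProjection Γ (Subgroup.zpowers w : Set G) π := by
  refine ⟨fun x => (hπ x).1, fun a ha => h.eq_of_isXProjection hπ ha, ?_⟩
  obtain ⟨R, hR⟩ := h.exists_dist_zpow_le hΓ hK hw
  obtain ⟨ρ, hρ⟩ := h.exists_dist_projection_le hΓ hK hw hπ (2 * δ' + R)
  refine ⟨2 * (ρ + R) + 2, _, by positivity,
    isSuperlinear_two_rpow (A := δ' + 1) (by positivity) (2 * δ' + R + 1), ?_⟩
  intro d hd x y p hfar hθ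
  have hθ : 2 * (ρ + R) + 2 < Γ.dist (π x) (π y) := by exact_mod_cast hθ
  obtain ⟨m, hm, hmd⟩ := hΓ.connected.exists_mem_geodInterval_dist_eq
    (Nat.div_le_self (Γ.dist (π x) (π y)) 2)
  obtain ⟨i, hi⟩ := (hπ x).1
  obtain ⟨j, hj⟩ := (hπ y).1
  have hi : w ^ i = π x := hi
  have hj : w ^ j = π y := hj
  obtain ⟨k, hk⟩ := hR i j m (by rwa [hi, hj])
  obtain ⟨z, hz, hmz⟩ := hΓ.slim.quadrilateral hΓ.connected (a := x) (b := y) hm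
  have hzk : Γ.dist z (w ^ k) ≤ 2 * δ' + R := by
    have h1 := hΓ.connected.dist_triangle (u := z) (v := m) (w := w ^ k)
    rw [Γ.dist_comm (u := z) (v := m)] at h1
    omega
  have hnot : ∀ x', ρ + R < Γ.dist m (π x') → z ∉ Γ.geodInterval x' (π x') := by
    intro x' hx' hz
    have h1 := hρ x' z k hz hzk
    have h2 := hΓ.connected.dist_triangle (u := m) (v := w ^ k) (w := π x')
    omega
  have hzxy : z ∈ Γ.geodInterval x y := by
    rw [mem_geodInterval] at hm
    rcases hz with hz | hz | hz
    · rw [geodInterval_comm] at hz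
      exact absurd hz (hnot x (by rw [dist_comm]; omega))
    · exact hz
    · exact absurd hz (hnot y (by omega))
  by_contra! hlen
  set e : ℝ := (d - (2 * δ' + R + 1)) / (δ' + 1) - 1 with he
  -- `e` is nonnegative, so rounding it up to a natural number costs less than `1`.
  have hpos : 1 ≤ p.length := by
    by_contra! h0
    obtain rfl := p.eq_of_length_eq_zero (by omega)
    rw [dist_self] at hθ
    omega
  have he0 : 0 ≤ e := by
    by_contra! hneg
    have h1 := Real.rpow_lt_one_of_one_lt_of_neg one_lt_two hneg
    have h2 : (1 : ℝ) ≤ p.length := by exact_mod_cast hpos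
    linarith
  have hM : p.length ≤ 2 ^ ⌈e⌉₊ := by
    have h1 : (p.length : ℝ) ≤ (2 : ℝ) ^ (⌈e⌉₊ : ℝ) :=
      hlen.trans (Real.rpow_le_rpow_of_exponent_le one_le_two (Nat.le_ceil e))
    rw [Real.rpow_natCast] at h1
    exact_mod_cast h1
  obtain ⟨t, ht, hzt⟩ :=
    hΓ.connected.comparison_self.exists_mem_support_dist_le hΓ.slim p hM hzxy
  have h1 := hfar t ht (w ^ k) ⟨k, rfl⟩
  have h2 := hΓ.connected.dist_triangle (u := t) (v := z) (w := w ^ k)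
  rw [Γ.dist_comm (u := t) (v := z)] at h2
  have h3 : (Γ.dist t (w ^ k) : ℝ) ≤ δ' * ⌈e⌉₊ + 1 + (2 * δ' + R) := by
    have : Γ.dist t (w ^ k) ≤ δ' * ⌈e⌉₊ + 1 + (2 * δ' + R) := by
      rw [one_mul] at hzt
      omega
    exact_mod_cast this
  have h4 : (⌈e⌉₊ : ℝ) < e + 1 := Nat.ceil_lt_add_one he0
  have h5 : (δ' + 1 : ℝ) * (e + 1) = d - (2 * δ' + R + 1) := by
    rw [he]
    field_simp
    ring
  have h6 : (0 : ℝ) ≤ δ' := Nat.cast_nonneg δ'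
  have h7 : (0 : ℝ) ≤ (⌈e⌉₊ : ℝ) := Nat.cast_nonneg _
  nlinarith

end InvariantSlim

theorem hasSuperDivergentElement_conedOffCayley [Infinite G] (hG : IsHyperbolicGroup G)
    {S : Set G} (hfin : S.Finite) (hS : Subgroup.closure S = ⊤) {𝓗 : Set (Subgroup G)} {C : ℝ}
    (h𝓗 : ∀ H ∈ 𝓗, H.index = 0 ∧ IsQuasiConvexWith (mulCayley S) C (H : Set G)) :
    HasSuperDivergentElement G (conedOffCayley S 𝓗) := by
  have hqc := fun H hH => (h𝓗 H hH).2
  obtain ⟨δ, hδ⟩ := mulCayley_invariantSlim hG hfin hS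
  obtain ⟨K, hK⟩ := conedOffCayley_comparison hG hfin hS hqc hfin hS
  obtain ⟨δ', hδ'⟩ := hK.exists_slim hδ.slim
  have hX : (conedOffCayley S 𝓗).InvariantSlim δ' :=
    ⟨hK.connected, conedOffCayley_adj_mul_left, hδ'⟩
  refine ⟨⟨hδ'.isHyperbolicGraph hK.connected, fun g x y => mulCayley_adj_mul_iff_right⟩, ?_⟩
  have hball := mulCayley_finite_setOf_len_le hfin hS
  obtain ⟨w, hw⟩ := hX.exists_isStraight fun n => by
    obtain ⟨u, hu⟩ := hδ.exists_dist_gt hball hfin hS hK.connected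
      ((hδ.finite_of_isQuasiConvexWith hball hqc).insert ⊥) (by
        rintro H (rfl | hH)
        · rw [Subgroup.index_bot]
          exact Nat.card_eq_zero_of_infinite
        · exact (h𝓗 H hH).1)
      (exists_mem_dist_le_of_conedOffCayley_adj hδ hqc) n
    exact ⟨u, hu.le⟩
  refine ⟨w, fun T hTfin hT x₀ => ?_⟩
  obtain ⟨δT, hδT⟩ := mulCayley_invariantSlim hG hTfin hT
  obtain ⟨KT, hKT⟩ := conedOffCayley_comparison hG hfin hS hqc hTfin hT
  exact ⟨hX.isLoxodromic hw, InvariantSlim.exists_isXProjection x₀ ⟨1, Subgroup.one_mem _⟩,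
    fun π hπ => hX.isSuperDivergentProjection hδT hKT hw hπ⟩

theorem conedOffCayley_empty (S : Set G) : conedOffCayley S ∅ = mulCayley S := by
  simp [conedOffCayley]

end SimpleGraph

theorem lemma3p1 (G : Type*) [Group G] [Infinite G] (hG : IsHyperbolicGroup G)
    (S : Set G) (hS_fin : S.Finite) (hS_gen : Subgroup.closure S = ⊤) :
    HasSuperDivergentElement G (SimpleGraph.mulCayley S) ∧
      ∀ (𝓗 : Set (Subgroup G)) (C : ℝ),
        (∀ H ∈ 𝓗, H.index = 0 ∧
          IsQuasiConvexWith (SimpleGraph.mulCayley S) C (H : Set G)) →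
        HasSuperDivergentElement G (conedOffCayley S 𝓗) := by
  refine ⟨?_, fun 𝓗 C h𝓗 =>
    SimpleGraph.hasSuperDivergentElement_conedOffCayley hG hS_fin hS_gen h𝓗⟩
  rw [← SimpleGraph.conedOffCayley_empty]
  exact SimpleGraph.hasSuperDivergentElement_conedOffCayley (C := 0) hG hS_fin hS_gen (by simp)
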